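/- Write $\mathbb N=\{1,2,\dots\}$, and let $n,d\in\mathbb N$. *Order.* For a tuple $x\in\mathbb N^m$ let $\max x$ be its largest entry, let $\tilde x\in\mathbb N^m$ be obtained from $x$ by replacing every entry smaller than $\max x$ by $1$, and let $x_*$ be obtained from $x$ by dropping all entries equal to $\max x$. Let $\prec_R$ be the right-to-left strict lexicographic order: $x\prec_R y$ if for some $i$ one has $x_i<y_i$ and $x_j=y_j$ for all $j>i$. The Ahlswede–Cai order $\prec$ on $\mathbb N^m$ is the strict total order defined recursively in $m$ as follows: for $x\ne y$, $x\prec y$ if either $\max x<\max y$; or $\max x=\max y$ and $\tilde x\prec_R\tilde y$; or $\max x=\max y>2$, $\tilde x=\tilde y$ and $x_*\prec y_*$. *Daisies.* For a nonempty $S\subset\{1,\dots,d\}$, a tuple $(q_i)_{i\in S}$ of positive integers is called DO1 if it is nonincreasing in $i$ and its first and last entries differ by at most $1$. Its value-change position is $\min S$ if the tuple is constant, and otherwise the smallest $j\in S$, $j>\min S$, such that $q_j<q_{\pi(j)}$, where $\pi(j)=\max\{i\in S:i<j\}$. A set $Q\subset\mathbb Z^d$ is a $d$-dimensional daisy if there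 are $h\in\{0,\dots,d-1\}$ and, for $k=0,\dots,h$, DO1 tuples $(q^{(d-k)}_j)_{j\in S_k}$ such that $S_0=\{1,\dots,d\}$; $S_k=S_{k-1}\setminus\{s_k\}$ for $1\le k\le h$, where $s_k$ is the value-change position of $(q^{(d-k+1)}_j)_{j\in S_{k-1}}$; for $1\le k\le h$ one has $q^{(d-k)}_i\le q^{(d-k+1)}_i$ for all $i\in S_k$, with strict inequality for at least one $i\in S_k$; and $$Q=\bigcup_{k=0}^{h}Q^{(d-k)},\qquad Q^{(d-k)}=A^{(d-k)}_1\times\dots\times A^{(d-k)}_d,$$ where $A^{(d-k)}_j=\{1,\dots,q^{(d-k)}_j\}$ if $j\in S_k$, and $A^{(d-k)}_j=\{q_j^{(d-r)}+1\}$ with $r=\max\{m\in\{0,\dots,k-1\}: j\in S_m\}$ if $j\notin S_k$. *Edge perimeter.* The edge perimeter of a finite set $C\subset\mathbb Z^d$ is the number of pairs $(x,y)\in C\times(\mathbb Z^d\setminus C)$ with $|x-y|=1$ (Euclidean norm). $C$ is an $EIP^d$ minimizer if no set $C'\subset\mathbb Z^d$ with $\#C'=\#C$ has smaller edge perimeter.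 **Theorem.** For all $n,d\in\mathbb N$ there exists a unique $d$-dimensional daisy $Q\subset\mathbb Z^d$ with $\#Q=n$. Moreover, $Q$ coincides with the set of the first $n$ elements of $\mathbb N^d$ with respect to the order $\prec$, and $Q$ is an $EIP^d$ minimizer. -/

import Mathlib

/-! Throughout, `{1, …, d}` is modelled by `Fin d`, and the positive integer tuples
`ℕ^d = {1, 2, …}^d` by the functions `Fin d → ℕ` all of whose values are at least `1`. -/

/-- `x ∈ {1, 2, …}^d`. -/
def IsPosTuple {d : ℕ} (x : Fin d → ℕ) : Prop :=
  ∀ i, 1 ≤ x i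

/-- The inclusion of natural tuples into the lattice `ℤ^d`. -/
def toLattice {d : ℕ} (x : Fin d → ℕ) : Fin d → ℤ :=
  fun i => (x i : ℤ)

/-! ### The order on positive tuples

The order is recursive in the dimension, through tuples from which some entries are dropped.
A tuple with dropped entries is described by the finset `S` of remaining indices: it is
`(x i)_{i ∈ S}`, read in increasing order of `i`, a tuple of dimension `#S`. -/

/-- `max x` for the tuple `(x i)_{i ∈ S}`. -/
def tupleMax {d : ℕ} (S : Finset (Fin d)) (x : Fin d → ℕ) : ℕ :=
  S.sup x

/-- `x̃` for the tuple `(x i)_{i ∈ S}`: entries below the maximum are replaced by `1`. -/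
def tupleTilde {d : ℕ} (S : Finset (Fin d)) (x : Fin d → ℕ) : Fin d → ℕ :=
  fun i => if x i < tupleMax S x then 1 else x i

/-- The right-to-left strict lexicographic order on tuples indexed by `S`. -/
def RightLex {d : ℕ} (S : Finset (Fin d)) (x y : Fin d → ℕ) : Prop :=
  ∃ i ∈ S, (∀ j ∈ S, i < j → x j = y j) ∧ x i < y i

/-- `PrecOn x y S` is the relation `≺` between the tuples `(x i)_{i ∈ S}` and `(y i)_{i ∈ S}`.
In the third instance `x` and `y` attain the common maximum at the same indices, and `x_*`, `y_*`
are the tuples indexed by the remaining ones. -/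
inductive PrecOn {d : ℕ} (x y : Fin d → ℕ) : Finset (Fin d) → Prop
  | max_lt (S : Finset (Fin d)) (hmax : tupleMax S x < tupleMax S y) : PrecOn x y S
  | tilde_lt (S : Finset (Fin d)) (hmax : tupleMax S x = tupleMax S y)
      (hlex : RightLex S (tupleTilde S x) (tupleTilde S y)) : PrecOn x y S
  | star_lt (S : Finset (Fin d)) (hmax : tupleMax S x = tupleMax S y)
      (htwo : 2 < tupleMax S x)
      (htilde : ∀ i ∈ S, tupleTilde S x i = tupleTilde S y i)
      (hstar : PrecOn x y (S.filter fun i => x i < tupleMax S x)) : PrecOn x y S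

/-- The order `≺` on `{1, 2, …}^d`. -/
def Prec {d : ℕ} (x y : Fin d → ℕ) : Prop :=
  PrecOn x y Finset.univ

/-- `F` is the string of the first `n` elements of `{1, 2, …}^d` with respect to `≺`: it consists
of `n` positive tuples, each of which precedes every positive tuple outside `F`. -/
def IsFirstString {d : ℕ} (n : ℕ) (F : Set (Fin d → ℕ)) : Prop :=
  (∀ x ∈ F, IsPosTuple x) ∧ F.encard = n ∧
    ∀ x ∈ F, ∀ y, IsPosTuple y → y ∉ F → Prec x y

/-! ### The edge-isoperimetric problem -/

/-- The edge boundary: ordered pairs `(x, y)` at Euclidean distance one, `x ∈ C`, `y ∉ C`. -/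
def edgeBoundary {d : ℕ} (C : Set (Fin d → ℤ)) : Set ((Fin d → ℤ) × (Fin d → ℤ)) :=
  {p | ∑ i, (p.1 i - p.2 i) ^ 2 = 1 ∧ p.1 ∈ C ∧ p.2 ∉ C}

/-- The edge perimeter. -/
noncomputable def edgePerimeter {d : ℕ} (C : Set (Fin d → ℤ)) : ℕ∞ :=
  (edgeBoundary C).encard

/-- A finite set is an edge-perimeter minimizer if its edge perimeter is the minimum over all
sets of the same cardinality. -/
def IsEIPMinimizer {d : ℕ} (C : Set (Fin d → ℤ)) : Prop :=
  C.Finite ∧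
    IsLeast {p : ℕ∞ | ∃ C' : Set (Fin d → ℤ), C'.encard = C.encard ∧ edgePerimeter C' = p}
      (edgePerimeter C)

/-! ### Daisies -/

/-- `DO1`-tuples indexed by `S`: positive, nonincreasing, with oscillation at most one. -/
def IsDO1On {d : ℕ} (S : Finset (Fin d)) (q : Fin d → ℕ) : Prop :=
  (∀ i ∈ S, 1 ≤ q i) ∧
  (∀ i ∈ S, ∀ j ∈ S, i < j → q j ≤ q i) ∧
  (∀ J₁ ∈ S, ∀ J₂ ∈ S, (∀ i ∈ S, J₁ ≤ i) → (∀ i ∈ S, i ≤ J₂) →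
    q J₁ = q J₂ ∨ q J₁ = q J₂ + 1)

/-- `i = π(j)`, the predecessor of `j` in `S`. -/
def IsPredIn {d : ℕ} (S : Finset (Fin d)) (i j : Fin d) : Prop :=
  IsGreatest {l : Fin d | l ∈ S ∧ l < j} i

/-- `t` is the value-change position of the tuple `(q i)_{i ∈ S}`: the first index if the tuple is
constant, and otherwise the first index whose entry is smaller than the previous one. -/
def IsValueChange {d : ℕ} (S : Finset (Fin d)) (q : Fin d → ℕ) (t : Fin d) : Prop :=
  ((∀ i ∈ S, ∀ j ∈ S, q i = q j) ∧ IsLeast {j : Fin d | j ∈ S} t) ∨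
  ((¬ ∀ i ∈ S, ∀ j ∈ S, q i = q j) ∧
    IsLeast {j : Fin d | j ∈ S ∧ ∃ i, IsPredIn S i j ∧ q j < q i} t)

/-- `S_{d,k} = {1, …, d} \ {s_1, …, s_k}`; here `s l` stands for `s_{l+1}`. -/
def freeIndices {d : ℕ} (s : ℕ → Fin d) (k : ℕ) : Finset (Fin d) :=
  Finset.univ.filter fun j => ∀ l < k, s l ≠ j

/-- `r_{j,k} = max {m ∈ {0, …, k-1} : j ∈ S_{d,m}}` (used for `k ≥ 1`; the set contains `0`). -/
def lastFree {d : ℕ} (s : ℕ → Fin d) (j : Fin d) (k : ℕ) : ℕ :=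
  Nat.findGreatest (fun m => j ∈ freeIndices s m) (k - 1)

/-- The constraints on the data of a daisy with layers `0, …, h`: here `q k j` stands for the
coefficient `q_j^{(d-k)}` (relevant for `j ∈ S_{d,k}`), and `s k` for `s_{k+1}`. -/
structure IsDaisyData {d : ℕ} (h : ℕ) (q : ℕ → Fin d → ℕ) (s : ℕ → Fin d) : Prop where
  h_lt : h < d
  do1 : ∀ k ≤ h, IsDO1On (freeIndices s k) (q k)
  change : ∀ k < h, IsValueChange (freeIndices s k) (q k) (s k)
  le : ∀ k < h, ∀ i ∈ freeIndices s (k + 1), q (k + 1) i ≤ q k i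
  lt : ∀ k < h, ∃ i ∈ freeIndices s (k + 1), q (k + 1) i < q k i

/-- The layer `Q^{(d-k)} = A_1 × … × A_d`, where `A_j = {1, …, q_j^{(d-k)}}` for `j ∈ S_{d,k}` and
`A_j = {q_j^{(d-r)} + 1}` with `r = r_{j,k}` for the other `j`. For `k = 0` this is the perfect
daisy with coefficients `q 0`. -/
def daisyLayer {d : ℕ} (q : ℕ → Fin d → ℕ) (s : ℕ → Fin d) (k : ℕ) : Set (Fin d → ℤ) :=
  {z | ∀ j, (j ∈ freeIndices s k → 1 ≤ z j ∧ z j ≤ (q k j : ℤ)) ∧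
    (j ∉ freeIndices s k → z j = (q (lastFree s j k) j : ℤ) + 1)}

/-- `Q ⊆ ℤ^d` is a `d`-dimensional daisy. -/
def IsDaisy {d : ℕ} (Q : Set (Fin d → ℤ)) : Prop :=
  ∃ (h : ℕ) (q : ℕ → Fin d → ℕ) (s : ℕ → Fin d),
    IsDaisyData h q s ∧ Q = {z | ∃ k ≤ h, z ∈ daisyLayer q s k}

/-! A daisy peels recursively: its largest layer is a nearly cubical box, with sides `c + 1` before
the value-change position `t` and `c` from `t` on, and the rest is a daisy of one dimension less in
the facet `x t = c + 1`. `DaisyOn` records this; `isDaisy_iff_exists_daisyOn` identifies it with the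
layered definition.

Order: a point of the daisy precedes every positive tuple outside it. Either the maximum, or the
last index where the maximum is attained, decides, or both points have the maximal entry `c + 1` at
`t`; this entry can be dropped (`PrecOn.of_erase`) and the smaller daisy takes over
(`DaisyOn.precOn`). As ≺ is asymmetric, the first `n` tuples are determined, so daisies of size `n`
are unique. Existence is greedy: take the largest box of the chain of size at most `n` and put the
remainder in the next facet.

Perimeter: each coordinate line meeting a set carries at least two boundary edges, and exactly two
if the set is down-closed, as a daisy is. So the total number of projection points must be
minimized. Its minimum is the explicit function `minShadow`, attained by daisies
(`DaisyOn.shadowSum_le`). The lower bound `minShadow_le_shadowSum` removes the smallest slice in the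
direction with most slices; it needs the numerical inequality `minShadow_le_sub_add`, which rests on
subadditivity and an exchange property of `minShadow`, proved together by induction on the
dimension. -/

/-! ### Sizes of nearly cubical boxes -/

/-- The size of the `t`-th box (counted from `0`) in the chain of `D`-dimensional boxes that starts
with the unit cube and in which the sides are enlarged by one cyclically. -/
def boxSize (D t : ℕ) : ℕ :=
  (t / D + 2) ^ (t % D) * (t / D + 1) ^ (D - t % D)

/-- The index, in the chain of `D`-dimensional boxes, of the facet that is added to the `t`-th
`D + 1`-dimensional box in order to get the next one. -/
def facetIndex (D t : ℕ) : ℕ :=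
  t - t / (D + 1)

theorem boxSize_mul_add {D a : ℕ} (q : ℕ) (ha : a ≤ D) :
    boxSize D (D * q + a) = (q + 2) ^ a * (q + 1) ^ (D - a) := by
  rcases Nat.eq_zero_or_pos D with rfl | hD
  · obtain rfl : a = 0 := by omega
    simp [boxSize]
  rcases ha.lt_or_eq with h | rfl
  · unfold boxSize
    rw [Nat.mul_add_div hD, Nat.mul_add_mod, Nat.div_eq_of_lt h, Nat.mod_eq_of_lt h, add_zero]
  · have h1 : a * q + a = a * (q + 1) := by ring
    unfold boxSize
    rw [h1, Nat.mul_div_cancel_left _ hD, Nat.mul_mod_right]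
    simp

theorem facetIndex_mul_add {D a : ℕ} (q : ℕ) (ha : a ≤ D) :
    facetIndex D ((D + 1) * q + a) = D * q + a := by
  unfold facetIndex
  rw [Nat.mul_add_div (by omega), Nat.div_eq_of_lt (by omega), add_zero, add_mul, one_mul]
  omega

theorem exists_eq_mul_add (D t : ℕ) : ∃ q a, a ≤ D ∧ t = (D + 1) * q + a :=
  ⟨t / (D + 1), t % (D + 1), Nat.le_of_lt_succ (Nat.mod_lt _ (by omega)),
    (Nat.div_add_mod t (D + 1)).symm⟩

theorem boxSize_pos (D t : ℕ) : 0 < boxSize D t := by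
  unfold boxSize
  positivity

theorem boxSize_zero (D : ℕ) : boxSize D 0 = 1 := by
  simp [boxSize]

theorem boxSize_succ (D t : ℕ) :
    boxSize (D + 1) (t + 1) = boxSize (D + 1) t + boxSize D (facetIndex D t) := by
  obtain ⟨q, a, ha, rfl⟩ := exists_eq_mul_add D t
  rw [facetIndex_mul_add q ha, boxSize_mul_add q ha, add_assoc, boxSize_mul_add q (by omega),
    boxSize_mul_add q (by omega), Nat.add_sub_add_right, Nat.sub_add_comm ha]
  ring

theorem boxSize_lt_succ (D t : ℕ) : boxSize (D + 1) t < boxSize (D + 1) (t + 1) := by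
  rw [boxSize_succ]
  have := boxSize_pos D (facetIndex D t)
  omega

theorem boxSize_strictMono (D : ℕ) : StrictMono (boxSize (D + 1)) :=
  strictMono_nat_of_lt_succ (boxSize_lt_succ D)

theorem facetIndex_le_succ (D t : ℕ) : facetIndex D t ≤ facetIndex D (t + 1) := by
  unfold facetIndex
  have h : (t + 1) / (D + 1) ≤ t / (D + 1) + 1 := by
    calc (t + 1) / (D + 1) ≤ (t + (D + 1)) / (D + 1) := Nat.div_le_div_right (by omega)
      _ = t / (D + 1) + 1 := Nat.add_div_right _ (by omega)
  omega

theorem facetIndex_zero_left (t : ℕ) : facetIndex 0 t = 0 := by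
  simp [facetIndex]

theorem facetSize_mono (D : ℕ) : Monotone fun t => boxSize D (facetIndex D t) := by
  apply monotone_nat_of_le_succ
  intro t
  cases D with
  | zero => simp [facetIndex_zero_left]
  | succ D => exact (boxSize_strictMono D).monotone (facetIndex_le_succ _ _)

theorem exists_boxSize_add {D n : ℕ} (hn : n ≠ 0) :
    ∃ t r, r < boxSize D (facetIndex D t) ∧ n = boxSize (D + 1) t + r := by
  have h0 : boxSize (D + 1) 0 ≤ n := by rw [boxSize_zero]; omega
  have h1 := Nat.findGreatest_spec (P := fun t => boxSize (D + 1) t ≤ n) (Nat.zero_le n) h0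
  set t := Nat.findGreatest (fun t => boxSize (D + 1) t ≤ n) n with ht
  refine ⟨t, n - boxSize (D + 1) t, ?_, by omega⟩
  by_contra! h2
  have h3 : boxSize (D + 1) (t + 1) ≤ n := by
    rw [boxSize_succ]
    omega
  have h4 : t + 1 ≤ n := ((boxSize_strictMono D).le_apply).trans h3
  have := Nat.le_findGreatest (P := fun t => boxSize (D + 1) t ≤ n) h4 h3
  omega

/-! ### The minimal number of projection points -/

/-- The smallest possible total number of points in the `D` coordinate projections of a set of `n`
lattice points of dimension `D`. -/
def minShadow : ℕ → ℕ → ℕ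
  | 0, _ => 0
  | D + 1, n =>
    if n = 0 then 0 else
      -- A unit cube has one projection point per direction. A facet glued to a box adds nothing
      -- along its normal, so it costs only its own shadow in dimension `D`; the same holds for the
      -- incomplete last facet.
      D + 1 + ∑ i ∈ Finset.range (Nat.findGreatest (fun t => boxSize (D + 1) t ≤ n) n),
        minShadow D (boxSize D (facetIndex D i)) +
      minShadow D (n - boxSize (D + 1) (Nat.findGreatest (fun t => boxSize (D + 1) t ≤ n) n))

@[simp] theorem minShadow_zero_left (n : ℕ) : minShadow 0 n = 0 := by
  simp [minShadow]

@[simp] theorem minShadow_zero (D : ℕ) : minShadow D 0 = 0 := by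
  cases D <;> simp [minShadow]

theorem findGreatest_boxSize {D t r : ℕ} (hr : r < boxSize D (facetIndex D t)) :
    Nat.findGreatest (fun s => boxSize (D + 1) s ≤ boxSize (D + 1) t + r)
      (boxSize (D + 1) t + r) = t := by
  rw [Nat.findGreatest_eq_iff]
  refine ⟨((boxSize_strictMono D).le_apply).trans (Nat.le_add_right _ _),
    fun _ => Nat.le_add_right _ _, fun s hs _ => ?_⟩
  have h1 : boxSize (D + 1) (t + 1) ≤ boxSize (D + 1) s := (boxSize_strictMono D).monotone hs
  rw [boxSize_succ] at h1
  omega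

theorem minShadow_add_of_lt {D t r : ℕ} (hr : r < boxSize D (facetIndex D t)) :
    minShadow (D + 1) (boxSize (D + 1) t + r) =
      D + 1 + ∑ i ∈ Finset.range t, minShadow D (boxSize D (facetIndex D i)) + minShadow D r := by
  have h := boxSize_pos (D + 1) t
  rw [minShadow, if_neg (by omega), findGreatest_boxSize hr, Nat.add_sub_cancel_left]

theorem minShadow_boxSize (D t : ℕ) :
    minShadow (D + 1) (boxSize (D + 1) t) =
      D + 1 + ∑ i ∈ Finset.range t, minShadow D (boxSize D (facetIndex D i)) := by
  simpa using minShadow_add_of_lt (r := 0) (boxSize_pos D (facetIndex D t))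

theorem minShadow_boxSize_succ (D t : ℕ) :
    minShadow (D + 1) (boxSize (D + 1) (t + 1)) =
      minShadow (D + 1) (boxSize (D + 1) t) + minShadow D (boxSize D (facetIndex D t)) := by
  rw [minShadow_boxSize, minShadow_boxSize, Finset.sum_range_succ]
  ring

/-- The recursion persists when the last facet is full, since the set is then the next box of the
chain. -/
theorem minShadow_add {D t r : ℕ} (hr : r ≤ boxSize D (facetIndex D t)) :
    minShadow (D + 1) (boxSize (D + 1) t + r) =
      minShadow (D + 1) (boxSize (D + 1) t) + minShadow D r := by
  rcases hr.lt_or_eq with h | rfl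
  · rw [minShadow_add_of_lt h, minShadow_boxSize]
  · rw [← boxSize_succ, minShadow_boxSize_succ]

theorem minShadow_one (D : ℕ) : minShadow D 1 = D := by
  cases D with
  | zero => simp
  | succ D =>
    have := minShadow_boxSize D 0
    simpa [boxSize_zero] using this

/-- Subadditivity of `minShadow D`. -/
def ShadowSubadditive (D : ℕ) : Prop :=
  ∀ x y, minShadow D (x + y) ≤ minShadow D x + minShadow D y

/-- Among the pairs of numbers with a given sum and bounded by the size of a box, those which contain
the size of the box have the smallest total `minShadow D`. -/
def ShadowExtremal (D : ℕ) : Prop :=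
  ∀ t r x y, r + boxSize D t = x + y → x ≤ boxSize D t → y ≤ boxSize D t →
    minShadow D r + minShadow D (boxSize D t) ≤ minShadow D x + minShadow D y

/-! ### Subadditivity and exchange: the induction on the dimension -/

section Step

variable {D : ℕ}

/-- The `c` extra points fill successive facets, and by subadditivity in dimension `D` splitting
them among facets does not lower their shadow. -/
theorem minShadow_boxSize_add_le (hsub : ShadowSubadditive D) (v c : ℕ) :
    minShadow (D + 1) (boxSize (D + 1) v) + minShadow D c ≤
      minShadow (D + 1) (boxSize (D + 1) v + c) := by
  induction c using Nat.strong_induction_on generalizing v with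
  | _ c ih =>
    rcases le_or_gt c (boxSize D (facetIndex D v)) with h | h
    · rw [minShadow_add h]
    · have hpos := boxSize_pos D (facetIndex D v)
      obtain ⟨e, rfl⟩ := Nat.exists_eq_add_of_le h.le
      have h1 := ih e (by omega) (v + 1)
      rw [boxSize_succ, add_assoc, ← boxSize_succ, minShadow_boxSize_succ] at h1
      have h2 := hsub (boxSize D (facetIndex D v)) e
      omega

/-- Compare with the unit cube: the remaining `c - 1` points cost at least their shadow in dimension
`D`. -/
theorem minShadow_le_succ (hsub : ShadowSubadditive D) (c : ℕ) :
    minShadow D c ≤ minShadow (D + 1) c := by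
  rcases Nat.eq_zero_or_pos c with rfl | hc
  · simp
  obtain ⟨e, rfl⟩ := Nat.exists_eq_add_of_le hc
  have h1 := minShadow_boxSize_add_le hsub 0 e
  have h2 := hsub 1 e
  rw [boxSize_zero, minShadow_one] at h1
  rw [minShadow_one] at h2
  simp only [Nat.succ_eq_add_one, zero_add] at *
  omega

/-- This is the core of the exchange step: completing the facet is at least as good as moving `c` of
its points onto the set of size `r`. What matters is whether these `c` points fit in the facet which
that set is currently filling. -/
theorem minShadow_add_facet_le (hsub : ShadowSubadditive D) (hext : ShadowExtremal D) {u r c e : ℕ}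
    (hr : r + c ≤ boxSize (D + 1) (u + 1)) (hc : c + e = boxSize D (facetIndex D u)) :
    minShadow (D + 1) r + minShadow D (boxSize D (facetIndex D u)) ≤
      minShadow (D + 1) (r + c) + minShadow D e := by
  rcases Nat.eq_zero_or_pos c with rfl | hc0
  · rw [zero_add] at hc
    simp [hc]
  rcases Nat.eq_zero_or_pos r with rfl | hr0
  · have h1 := minShadow_le_succ hsub c
    have h2 := hsub c e
    rw [hc] at h2
    simp only [minShadow_zero, zero_add]
    omega
  obtain ⟨v, ρ, hρ, rfl⟩ := exists_boxSize_add (D := D) hr0.ne'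
  have hvu : v ≤ u := by
    have : boxSize (D + 1) v < boxSize (D + 1) (u + 1) := by omega
    have := (boxSize_strictMono D).lt_iff_lt.1 this
    omega
  have hf : boxSize D (facetIndex D v) ≤ boxSize D (facetIndex D u) := facetSize_mono D hvu
  rw [minShadow_add hρ.le]
  rcases le_or_gt (ρ + c) (boxSize D (facetIndex D v)) with h | h
  · rw [add_assoc (boxSize (D + 1) v), minShadow_add h]
    have := hext (facetIndex D u) ρ (ρ + c) e (by omega) (by omega) (by omega)
    omega
  -- Here `x` points complete the current facet and `c'` overflow. The exchange property trades `ρ`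
  -- and the big facet for the completed facet and `c' + e`, and subadditivity separates `c'` from
  -- `e`.
  · obtain ⟨x, hx⟩ := Nat.exists_eq_add_of_le hρ.le
    obtain ⟨c', rfl⟩ := Nat.exists_eq_add_of_le (show x ≤ c by omega)
    have h1 := minShadow_boxSize_add_le hsub (v + 1) c'
    rw [minShadow_boxSize_succ] at h1
    have h2 : boxSize (D + 1) (v + 1) + c' = boxSize (D + 1) v + ρ + (x + c') := by
      rw [boxSize_succ]; omega
    rw [h2] at h1
    have h3 := hext (facetIndex D u) ρ (boxSize D (facetIndex D v)) (c' + e) (by omega) hf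
      (by omega)
    have h4 := hsub c' e
    omega

/-- If `y` contains the previous box, then `y` is that box plus `e` and `x = r + c`, where `c + e`
is exactly the facet between the two boxes. -/
theorem ShadowExtremal.of_le (hsub : ShadowSubadditive D) (hext : ShadowExtremal D) {t r x y : ℕ}
    (h : r + boxSize (D + 1) (t + 1) = x + y) (hx : x ≤ boxSize (D + 1) (t + 1))
    (hy : y ≤ boxSize (D + 1) (t + 1)) (hty : boxSize (D + 1) t ≤ y) :
    minShadow (D + 1) r + minShadow (D + 1) (boxSize (D + 1) (t + 1)) ≤
      minShadow (D + 1) x + minShadow (D + 1) y := by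
  have hs := boxSize_succ D t
  obtain ⟨e, rfl⟩ := Nat.exists_eq_add_of_le hty
  obtain ⟨c, rfl⟩ := Nat.exists_eq_add_of_le (show r ≤ x by omega)
  have h1 := minShadow_add_facet_le hsub hext (u := t) (r := r) (c := c) (e := e) hx (by omega)
  rw [minShadow_boxSize_succ, minShadow_add (by omega)]
  omega

theorem ShadowExtremal.succ (hsub : ShadowSubadditive D) (hext : ShadowExtremal D) :
    ShadowExtremal (D + 1) := by
  intro t
  induction t with
  | zero =>
    intro r x y h hx hy
    rw [boxSize_zero] at *
    have : (x = r ∧ y = 1) ∨ (x = 1 ∧ y = r) := by omega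
    rcases this with ⟨rfl, rfl⟩ | ⟨rfl, rfl⟩ <;> omega
  | succ t ih =>
    intro r x y h hx hy
    rcases le_or_gt (boxSize (D + 1) t) y with hty | hty
    · exact ShadowExtremal.of_le hsub hext h hx hy hty
    rcases le_or_gt (boxSize (D + 1) t) x with htx | htx
    · have := ShadowExtremal.of_le hsub hext (h.trans (add_comm _ _)) hy hx htx
      omega
    have hs := boxSize_lt_succ D t
    -- Both numbers lie below the previous box, so pass through the pair consisting of `w` and that
    -- box: the induction hypothesis reaches it, and the case already treated leads on from it.
    obtain ⟨w, hw⟩ := Nat.exists_eq_add_of_le (show boxSize (D + 1) t ≤ x + y by omega)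
    have h1 := ih w x y (by omega) htx.le hty.le
    have h2 := ShadowExtremal.of_le hsub hext (t := t) (r := r) (x := w) (y := boxSize (D + 1) t)
      (by omega) (by omega) hs.le le_rfl
    omega

/-- If one summand contains the largest box in the sum, the other lies inside the last facet and
subadditivity one dimension lower suffices. Otherwise the exchange property pulls out that box. -/
theorem ShadowSubadditive.succ (hsub : ShadowSubadditive D) (hext : ShadowExtremal (D + 1)) :
    ShadowSubadditive (D + 1) := by
  have key : ∀ u σ x y, σ < boxSize D (facetIndex D u) → x + y = boxSize (D + 1) u + σ →
      boxSize (D + 1) u ≤ x →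
      minShadow (D + 1) (x + y) ≤ minShadow (D + 1) x + minShadow (D + 1) y := by
    intro u σ x y hσ h hx
    obtain ⟨ρ, rfl⟩ := Nat.exists_eq_add_of_le hx
    rw [add_assoc, minShadow_add (by omega), minShadow_add (by omega)]
    have h1 := hsub ρ y
    have h2 := minShadow_le_succ hsub y
    omega
  intro x y
  rcases Nat.eq_zero_or_pos (x + y) with h0 | h0
  · rw [h0]; simp
  obtain ⟨u, σ, hσ, h⟩ := exists_boxSize_add (D := D) h0.ne'
  rcases le_or_gt (boxSize (D + 1) u) x with hx | hx
  · exact key u σ x y hσ h hx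
  rcases le_or_gt (boxSize (D + 1) u) y with hy | hy
  · have := key u σ y x hσ ((add_comm _ _).trans h) hy
    rw [add_comm y x] at this
    omega
  have h1 := hext u σ x y (by omega) hx.le hy.le
  have h2 := minShadow_le_succ hsub σ
  rw [h, minShadow_add hσ.le]
  omega

end Step

theorem shadowSubadditive_and_extremal (D : ℕ) : ShadowSubadditive D ∧ ShadowExtremal D := by
  induction D with
  | zero => exact ⟨fun _ _ => by simp, fun _ _ _ _ _ _ _ => by simp⟩
  | succ D ih =>
    have h := ShadowExtremal.succ ih.1 ih.2
    exact ⟨ShadowSubadditive.succ ih.1 h, h⟩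

/-! ### Removing a thin layer, and the shadow of a box -/

theorem succ_mul_boxSize {D a : ℕ} (q : ℕ) (ha : a ≤ D) :
    (q + 2) * boxSize D (D * q + a) = boxSize (D + 1) ((D + 1) * q + a + 1) := by
  rw [add_assoc, boxSize_mul_add q ha, boxSize_mul_add q (by omega), Nat.add_sub_add_right]
  ring

/-- Removing a layer which is small in comparison with the side of a cube that could contain the set
does not decrease `minShadow` by more than the shadow of the layer. -/
theorem minShadow_le_sub_add (D : ℕ) : ∀ {c n b : ℕ}, 1 ≤ c → (c + 1) * b ≤ n → n ≤ (c + 1) ^ D →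
    minShadow D n ≤ minShadow D (n - b) + minShadow (D - 1) b := by
  induction D with
  | zero => simp
  | succ D ih =>
    intro c n b hc hb hn
    obtain ⟨hsub, hext⟩ := shadowSubadditive_and_extremal D
    rcases Nat.eq_zero_or_pos b with rfl | hb0
    · simp
    have hn2 : 2 ≤ n := by nlinarith
    -- Decomposing `n - 1` makes the last facet nonempty and possibly full: its size, renamed `r`
    -- below, runs from `1` to the full facet.
    obtain ⟨t, r, hr, hnr⟩ := exists_boxSize_add (D := D) (n := n - 1) (by omega)
    replace hnr : n = boxSize (D + 1) t + (r + 1) := by omega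
    replace hr : r + 1 ≤ boxSize D (facetIndex D t) := hr
    have hr0 : 0 < r + 1 := r.succ_pos
    generalize r + 1 = r at hr hnr hr0
    obtain ⟨q, a, ha, ht⟩ := exists_eq_mul_add D t
    have hft : (q + 2) * boxSize D (facetIndex D t) = boxSize (D + 1) (t + 1) := by
      rw [ht, facetIndex_mul_add q ha, succ_mul_boxSize q ha]
    -- The box of index `t` contains a cube of side `q + 1` and has fewer than `n ≤ (c + 1) ^ (D +
    -- 1)` points.
    have hqc : q + 2 ≤ c + 1 := by
      have h1 : (q + 1) ^ (D + 1) ≤ boxSize (D + 1) t := by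
        have h2 := (boxSize_strictMono D).monotone (show (D + 1) * q + 0 ≤ t by omega)
        rw [boxSize_mul_add q (by omega)] at h2
        simpa using h2
      exact lt_of_pow_lt_pow_left₀ (D + 1) (by omega) (by omega : (q + 1) ^ (D + 1) < _)
    have hqb : (q + 2) * b ≤ n := (Nat.mul_le_mul_right b hqc).trans hb
    have hbf : b ≤ boxSize D (facetIndex D t) := by
      have := boxSize_succ D t
      refine Nat.le_of_mul_le_mul_left (hqb.trans ?_) (show 0 < q + 2 by omega)
      omega
    rw [Nat.add_sub_cancel]
    subst hnr
    rw [minShadow_add hr]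
    rcases le_or_gt b r with hbr | hbr
    · obtain ⟨e, rfl⟩ := Nat.exists_eq_add_of_le hbr
      have h1 : boxSize (D + 1) t + (b + e) - b = boxSize (D + 1) t + e := by omega
      rw [h1, minShadow_add (by omega)]
      have := hsub b e
      omega
    cases t with
    | zero =>
      have h1 := facetIndex_mul_add (D := D) 0 (Nat.zero_le D)
      simp only [mul_zero, add_zero] at h1
      rw [h1, boxSize_zero] at hr hbf
      omega
    | succ t =>
    have hs := boxSize_succ D t
    rw [minShadow_boxSize_succ]
    rcases le_or_gt b (boxSize D (facetIndex D t)) with hbt | hbt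
    · obtain ⟨e, he⟩ := Nat.exists_eq_add_of_le hbt
      have h1 : boxSize (D + 1) (t + 1) + r - b = boxSize (D + 1) t + (r + e) := by omega
      rw [h1, minShadow_add (by omega)]
      have := hext (facetIndex D t) r (r + e) b (by omega) (by omega) hbt
      omega
    obtain ⟨s, rfl⟩ := Nat.exists_eq_add_of_le hbt.le
    cases a with
    | zero =>
      -- The current box is a cube, so the facet that completed it and the next one have equal size,
      -- leaving no room for `b` strictly above the first.
      exfalso
      cases q with
      | zero => simp at ht
      | succ q =>
        have h1 : t = (D + 1) * q + D := by
          have : (D + 1) * (q + 1) = (D + 1) * q + D + 1 := by ring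
          omega
        have h2 : facetIndex D (t + 1) = facetIndex D t := by
          rw [ht, h1, facetIndex_mul_add _ ha, facetIndex_mul_add _ le_rfl]
          ring
        rw [h2] at hbf
        omega
    | succ a =>
    have ht' : t = (D + 1) * q + a := by omega
    -- Subtracting this from `(q + 2) * b ≤ n` leaves the same thinness condition for `s` inside the
    -- last facet, so the induction hypothesis applies there.
    have hqt : (q + 2) * boxSize D (facetIndex D t) = boxSize (D + 1) (t + 1) := by
      rw [ht', facetIndex_mul_add q (by omega), succ_mul_boxSize q (by omega)]
    have hqs : (q + 2) * s ≤ r := by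
      rw [mul_add] at hqb
      omega
    have hsr : s ≤ r := le_trans (Nat.le_mul_of_pos_left s (by omega)) hqs
    have h1 : boxSize (D + 1) (t + 1) + r - (boxSize D (facetIndex D t) + s) =
        boxSize (D + 1) t + (r - s) := by omega
    rw [h1, minShadow_add (by omega)]
    have hrD : r ≤ (q + 2) ^ D := by
      refine hr.trans ?_
      rw [ht, facetIndex_mul_add q ha, boxSize_mul_add q ha]
      calc (q + 2) ^ (a + 1) * (q + 1) ^ (D - (a + 1))
          ≤ (q + 2) ^ (a + 1) * (q + 2) ^ (D - (a + 1)) := by gcongr; omega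
        _ = (q + 2) ^ D := by rw [← pow_add]; congr 1; omega
    have h2 := ih (c := q + 1) (n := r) (b := s) (by omega) hqs hrD
    -- The two facets are consecutive boxes of the `D`-dimensional chain, and `b` lies between them.
    have h3 : minShadow D (boxSize D (facetIndex D t) + s) =
        minShadow D (boxSize D (facetIndex D t)) + minShadow (D - 1) s := by
      cases D with
      | zero => omega
      | succ D =>
        rw [ht', facetIndex_mul_add q (by omega)]
        rw [ht, ht', facetIndex_mul_add q ha, facetIndex_mul_add q (by omega), ← add_assoc,
          boxSize_succ] at hbf
        exact minShadow_add (by omega)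
    omega

/-- A box with `a` sides `q + 2` and `D - a` sides `q + 1` projects along a side to its size divided
by that side; the factor in front clears denominators. -/
theorem minShadow_boxSize_closed (D : ℕ) : ∀ {a : ℕ} (q : ℕ), a ≤ D →
    (q + 1) * (q + 2) * minShadow D (boxSize D (D * q + a)) =
      boxSize D (D * q + a) * (a * (q + 1) + (D - a) * (q + 2)) := by
  induction D with
  | zero =>
    intro a q ha
    obtain rfl : a = 0 := by omega
    simp
  | succ D ih =>
    have key : ∀ t q a, a ≤ D + 1 → t = (D + 1) * q + a →
        (q + 1) * (q + 2) * minShadow (D + 1) (boxSize (D + 1) t) =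
          boxSize (D + 1) t * (a * (q + 1) + (D + 1 - a) * (q + 2)) := by
      intro t
      induction t with
      | zero =>
        intro q a ha ht
        obtain rfl : a = 0 := by omega
        obtain rfl : q = 0 := by simpa using ht.symm
        simp [boxSize_zero, minShadow_one]
        ring
      | succ t iht =>
        have main : ∀ q a, a ≤ D → t = (D + 1) * q + a →
            (q + 1) * (q + 2) * minShadow (D + 1) (boxSize (D + 1) (t + 1)) =
              boxSize (D + 1) (t + 1) * ((a + 1) * (q + 1) + (D - a) * (q + 2)) := by
          intro q a ha ht
          have h1 := iht q a (by omega) ht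
          have h2 := ih q ha
          rw [minShadow_boxSize_succ, boxSize_succ, mul_add, h1, ht, facetIndex_mul_add q ha, h2,
            boxSize_mul_add q (by omega), boxSize_mul_add q ha]
          obtain ⟨e, rfl⟩ := Nat.exists_eq_add_of_le ha
          have e1 : a + e + 1 - a = e + 1 := by omega
          have e2 : a + e - a = e := by omega
          rw [e1, e2]
          ring
        intro q a ha ht
        cases a with
        | succ a =>
          have := main q a (by omega) (by omega)
          rwa [Nat.add_sub_add_right]
        | zero =>
          cases q with
          | zero => simp at ht
          | succ q =>
            have h0 : (D + 1) * (q + 1) = (D + 1) * q + D + 1 := by ring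
            -- A cube is reached as the end `a = D + 1` of the previous cycle; its formula carries
            -- an extra factor `q + 1`, which is cancelled.
            have h1 := main q D le_rfl (by omega)
            have h2 : minShadow (D + 1) (boxSize (D + 1) (t + 1)) * (q + 2) =
                boxSize (D + 1) (t + 1) * (D + 1) := by
              apply Nat.eq_of_mul_eq_mul_left (show 0 < q + 1 by omega)
              simp only [Nat.sub_self, zero_mul, add_zero] at h1
              linarith
            simp only [Nat.sub_zero, zero_mul, zero_add]
            linear_combination (q + 1 + 2) * h2
    intro a q ha
    exact key _ q a ha rfl

/-! ### Projections and the edge perimeter -/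

/-- The total number of points in the projections of `C` along the directions in `S`. -/
def shadowSum {ι α : Type*} [DecidableEq ι] [DecidableEq α] [Zero α] [DecidableEq (ι → α)]
    (S : Finset ι) (C : Finset (ι → α)) : ℕ :=
  ∑ i ∈ S, (C.image fun x => Function.update x i 0).card

theorem card_le_pow_card_image {ι α : Type*} [DecidableEq ι] [DecidableEq α]
    {S : Finset ι} {C : Finset (ι → α)} {m : ℕ}
    (hC : ∀ x ∈ C, ∀ y ∈ C, ∀ i ∉ S, x i = y i)
    (hm : ∀ i ∈ S, (C.image fun x => x i).card ≤ m) : C.card ≤ m ^ S.card := by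
  have h1 : C.card ≤ (S.pi fun i => C.image fun x => x i).card := by
    refine Finset.card_le_card_of_injOn (fun x i _ => x i) ?_ ?_
    · intro x hx
      exact Finset.mem_coe.2 (Finset.mem_pi.2 fun i _ => Finset.mem_image_of_mem (fun x => x i) hx)
    · intro x hx y hy hxy
      funext i
      by_cases hi : i ∈ S
      · exact congrFun (congrFun hxy i) hi
      · exact hC x hx y hy i hi
  rw [Finset.card_pi] at h1
  exact h1.trans (Finset.prod_le_pow_card _ _ _ hm)

section Shadow

variable {ι α : Type*} [DecidableEq ι] [DecidableEq α] [Zero α] [DecidableEq (ι → α)]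

/-- Projecting along `j ≠ i` keeps the coordinate `i`, so the slice and its complement have disjoint
projections. Along `i` only the complement is counted. -/
theorem shadowSum_filter_add_le {S : Finset ι} {i : ι} (hi : i ∈ S) (C : Finset (ι → α)) (v : α) :
    shadowSum S (C.filter fun x => ¬ x i = v) + shadowSum (S.erase i) (C.filter fun x => x i = v) ≤
      shadowSum S C := by
  unfold shadowSum
  rw [← Finset.add_sum_erase S _ hi, ← Finset.add_sum_erase S _ hi, add_assoc,
    ← Finset.sum_add_distrib]
  refine add_le_add (Finset.card_le_card (Finset.image_subset_image (Finset.filter_subset _ _)))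
    (Finset.sum_le_sum fun j hj => ?_)
  have hji : i ≠ j := (Finset.ne_of_mem_erase hj).symm
  rw [← Finset.card_union_of_disjoint]
  · refine Finset.card_le_card (Finset.union_subset ?_ ?_) <;>
      exact Finset.image_subset_image (Finset.filter_subset _ _)
  · rw [Finset.disjoint_left]
    intro p hp hp'
    obtain ⟨x, hx, rfl⟩ := Finset.mem_image.1 hp
    obtain ⟨y, hy, hxy⟩ := Finset.mem_image.1 hp'
    have h := congrFun hxy i
    rw [Function.update_of_ne hji, Function.update_of_ne hji] at h
    exact (Finset.mem_filter.1 hx).2 (h ▸ (Finset.mem_filter.1 hy).2)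

/-- A discrete isoperimetric inequality for the projections. -/
theorem minShadow_le_shadowSum (S : Finset ι) (C : Finset (ι → α))
    (hC : ∀ x ∈ C, ∀ y ∈ C, ∀ i ∉ S, x i = y i) : minShadow S.card C.card ≤ shadowSum S C := by
  induction hN : C.card using Nat.strong_induction_on generalizing S C with
  | _ N ih =>
  subst hN
  rcases S.eq_empty_or_nonempty with rfl | hS
  · simp
  rcases C.eq_empty_or_nonempty with rfl | hCne
  · simp
  -- With `m` the largest number of slices over all directions, `C` has at most `m ^ S.card` points,
  -- and the smallest slice in direction `i` has at most the fraction `1 / m` of them. These are the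
  -- hypotheses of `minShadow_le_sub_add` with `c = m - 1`.
  obtain ⟨i, hi, hmax⟩ := Finset.exists_max_image S (fun i => (C.image fun x => x i).card) hS
  set m := (C.image fun x => x i).card with hm
  have hpow := card_le_pow_card_image hC hmax
  rcases le_or_gt m 1 with hm1 | hm1
  · have h1 : C.card = 1 := by
      have := hCne.card_pos
      have := hpow.trans (Nat.pow_le_pow_left hm1 _)
      rw [one_pow] at this
      omega
    rw [h1, minShadow_one]
    unfold shadowSum
    calc S.card = ∑ _i ∈ S, 1 := by simp
      _ ≤ _ := Finset.sum_le_sum fun j _ => Finset.card_pos.2 (hCne.image _)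
  obtain ⟨v, hv, hmin⟩ := Finset.exists_min_image (C.image fun x => x i)
    (fun v => (C.filter fun x : ι → α => x i = v).card) (hCne.image _)
  set b := (C.filter fun x => x i = v).card with hb
  have hsum : m * b ≤ C.card := by
    rw [Finset.card_eq_sum_card_image (fun x => x i) C]
    simpa [hm] using Finset.card_nsmul_le_sum _ _ _ hmin
  have hb0 : 0 < b := by
    obtain ⟨x, hx, rfl⟩ := Finset.mem_image.1 hv
    exact Finset.card_pos.2 ⟨x, Finset.mem_filter.2 ⟨hx, rfl⟩⟩
  have hadd : b + (C.filter fun x => ¬ x i = v).card = C.card :=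
    Finset.card_filter_add_card_filter_not _
  have hblt : b < C.card := by nlinarith
  have h1 := ih _ (show (C.filter fun x => ¬ x i = v).card < C.card by omega) S
    (C.filter fun x => ¬ x i = v)
    (fun x hx y hy => hC x (Finset.mem_filter.1 hx).1 y (Finset.mem_filter.1 hy).1) rfl
  have h2 := ih b hblt (S.erase i) (C.filter fun x => x i = v) (by
    intro x hx y hy j hj
    by_cases hji : j = i
    · subst hji
      exact (Finset.mem_filter.1 hx).2.trans (Finset.mem_filter.1 hy).2.symm
    · exact hC x (Finset.mem_filter.1 hx).1 y (Finset.mem_filter.1 hy).1 j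
        fun hjS => hj (Finset.mem_erase.2 ⟨hji, hjS⟩)) rfl
  have h3 := shadowSum_filter_add_le hi C v
  have h4 := minShadow_le_sub_add S.card (c := m - 1) (n := C.card) (b := b) (by omega)
    (by rwa [Nat.sub_add_cancel hm1.le]) (by rwa [Nat.sub_add_cancel hm1.le])
  rw [Finset.card_erase_of_mem hi] at h2
  have h5 : C.card - b = (C.filter fun x => ¬ x i = v).card := by omega
  rw [h5] at h4
  omega

end Shadow

/-! ### Boundary edges and coordinate lines -/

section Perimeter

variable {d : ℕ}

theorem sum_sq_sub_update (x : Fin d → ℤ) (i : Fin d) (ε : ℤ) :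
    ∑ j, (x j - Function.update x i (x i + ε) j) ^ 2 = ε ^ 2 := by
  rw [Finset.sum_eq_single i]
  · simp
  · intro j _ hj
    simp [Function.update_of_ne hj]
  · simp

theorem exists_eq_update_of_sum_sq {x y : Fin d → ℤ} (h : ∑ i, (x i - y i) ^ 2 = 1) :
    ∃ i, ∃ ε ∈ ({1, -1} : Finset ℤ), y = Function.update x i (x i + ε) := by
  obtain ⟨i, hi⟩ : ∃ i, x i - y i ≠ 0 := by
    by_contra! h0
    simp [h0] at h
  have hsplit := Finset.add_sum_erase Finset.univ (fun i => (x i - y i) ^ 2) (Finset.mem_univ i)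
  have hpos : 0 ≤ ∑ j ∈ Finset.univ.erase i, (x j - y j) ^ 2 :=
    Finset.sum_nonneg fun j _ => sq_nonneg _
  have hi1 : 0 < (x i - y i) ^ 2 := by positivity
  have h1 : (x i - y i) ^ 2 = 1 := by omega
  have h0 : ∑ j ∈ Finset.univ.erase i, (x j - y j) ^ 2 = 0 := by omega
  rw [Finset.sum_eq_zero_iff_of_nonneg fun j _ => sq_nonneg _] at h0
  refine ⟨i, y i - x i, ?_, ?_⟩
  · rw [sq] at h1
    simp only [Finset.mem_insert, Finset.mem_singleton]
    rcases mul_self_eq_one_iff.1 h1 with h | h <;> omega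
  · funext j
    by_cases hj : j = i
    · subst hj; simp
    · rw [Function.update_of_ne hj]
      have := h0 j (Finset.mem_erase.2 ⟨hj, Finset.mem_univ _⟩)
      have := pow_eq_zero_iff (two_ne_zero) |>.1 this
      omega

theorem update_add_injective {x : Fin d → ℤ} {i j : Fin d} {ε δ : ℤ} (hε : ε ≠ 0)
    (h : Function.update x i (x i + ε) = Function.update x j (x j + δ)) : i = j ∧ ε = δ := by
  have h1 := congrFun h i
  by_cases hij : i = j
  · subst hij
    simpa using h1
  · rw [Function.update_self, Function.update_of_ne hij] at h1
    omega

/-- The directions, orientations and projection points which label the boundary edges of sets whose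
sections along coordinate lines are intervals. -/
def shadowLabels {α : Type*} [DecidableEq α] [Zero α] (C : Finset (Fin d → α)) :
    Finset (Σ _ : Fin d, ℤ × (Fin d → α)) :=
  Finset.univ.sigma fun i =>
    ({1, -1} : Finset ℤ) ×ˢ (C.image fun x => Function.update x i 0)

theorem card_shadowLabels {α : Type*} [DecidableEq α] [Zero α] (C : Finset (Fin d → α)) :
    (shadowLabels C).card = 2 * shadowSum Finset.univ C := by
  simp [shadowLabels, shadowSum, Finset.card_sigma, Finset.card_product, Finset.mul_sum]

/-- On each line meeting `C`, the extreme point in the orientation `ε` has its next neighbour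
outside. -/
theorem exists_mem_update_add_notMem {C : Finset (Fin d → ℤ)} {i : Fin d} {ε : ℤ}
    (hε : ε ∈ ({1, -1} : Finset ℤ)) {p : Fin d → ℤ}
    (hp : p ∈ C.image fun x => Function.update x i 0) :
    ∃ x ∈ C, Function.update x i 0 = p ∧ Function.update x i (x i + ε) ∉ C := by
  obtain ⟨y, hy, hyp⟩ := Finset.mem_image.1 hp
  obtain ⟨x, hx, hmax⟩ := Finset.exists_max_image (C.filter fun x => Function.update x i 0 = p)
    (fun x => ε * x i) ⟨y, Finset.mem_filter.2 ⟨hy, hyp⟩⟩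
  rw [Finset.mem_filter] at hx
  refine ⟨x, hx.1, hx.2, fun hmem => ?_⟩
  have := hmax _ (Finset.mem_filter.2 ⟨hmem, by simpa using hx.2⟩)
  simp only [Finset.mem_insert, Finset.mem_singleton] at hε
  rcases hε with rfl | rfl <;> simp at this

theorem two_mul_shadowSum_le_edgePerimeter (C : Finset (Fin d → ℤ)) :
    ((2 * shadowSum Finset.univ C : ℕ) : ℕ∞) ≤ edgePerimeter (C : Set (Fin d → ℤ)) := by
  have h : ∀ l : Σ _ : Fin d, ℤ × (Fin d → ℤ), l ∈ shadowLabels C →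
      ∃ x ∈ C, Function.update x l.1 0 = l.2.2 ∧ Function.update x l.1 (x l.1 + l.2.1) ∉ C := by
    intro l hl
    simp only [shadowLabels, Finset.mem_sigma, Finset.mem_product] at hl
    exact exists_mem_update_add_notMem hl.2.1 hl.2.2
  choose! f hf hfp hfn using h
  rw [← card_shadowLabels, ← Set.encard_coe_eq_coe_finsetCard]
  refine Set.encard_le_encard_of_injOn
    (f := fun l => (f l, Function.update (f l) l.1 (f l l.1 + l.2.1))) ?_ ?_
  · intro l hl
    refine ⟨?_, hf l hl, hfn l hl⟩
    simp only [sum_sq_sub_update]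
    simp only [shadowLabels, Finset.coe_sigma, Set.mem_sigma_iff, Finset.mem_coe,
      Finset.mem_product, Finset.mem_insert, Finset.mem_singleton] at hl
    rcases hl.2.1 with h | h <;> simp [h]
  · intro l hl l' hl' hll
    simp only [Prod.mk.injEq] at hll
    obtain ⟨h1, h2⟩ := hll
    have hε : l.2.1 ≠ 0 := by
      simp only [shadowLabels, Finset.coe_sigma, Set.mem_sigma_iff, Finset.mem_coe,
        Finset.mem_product, Finset.mem_insert, Finset.mem_singleton] at hl
      rcases hl.2.1 with h | h <;> simp [h]
    rw [← h1] at h2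
    obtain ⟨h3, h4⟩ := update_add_injective hε h2
    have h5 := hfp l hl
    have h6 := hfp l' hl'
    rw [← h1, ← h3, h5] at h6
    obtain ⟨i, ε, p⟩ := l
    obtain ⟨i', ε', p'⟩ := l'
    simp only at h3 h4 h6
    subst h3 h4 h6
    rfl

theorem toLattice_injective : Function.Injective (toLattice (d := d)) := by
  intro x y h
  funext i
  have := congrFun h i
  simpa [toLattice] using this

theorem toLattice_update (x : Fin d → ℕ) (i : Fin d) (k : ℕ) :
    toLattice (Function.update x i k) = Function.update (toLattice x) i (k : ℤ) := by
  funext j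
  by_cases hj : j = i
  · subst hj; simp [toLattice]
  · simp [toLattice, Function.update_of_ne hj]

/-- The section of a down-closed set along a line is an initial interval, so a boundary edge is
determined by its line and its orientation. -/
theorem edgePerimeter_toLattice_le [Nonempty (Fin d)] {C : Finset (Fin d → ℕ)} (hpos : ∀ x ∈ C, IsPosTuple x)
    (hdown : ∀ x ∈ C, ∀ i k, 1 ≤ k → k ≤ x i → Function.update x i k ∈ C) :
    edgePerimeter (toLattice '' (C : Set (Fin d → ℕ))) ≤
      ((2 * shadowSum Finset.univ C : ℕ) : ℕ∞) := by
  have h : ∀ e : (Fin d → ℤ) × (Fin d → ℤ),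
      e ∈ edgeBoundary (toLattice '' (C : Set (Fin d → ℕ))) →
      ∃ x : Fin d → ℕ, ∃ i : Fin d, ∃ ε : ℤ, x ∈ C ∧ ε ∈ ({1, -1} : Finset ℤ) ∧
        e.1 = toLattice x ∧ e.2 = Function.update (toLattice x) i (x i + ε) := by
    rintro ⟨a, b⟩ ⟨h1, ⟨x, hx, rfl⟩, h3⟩
    obtain ⟨i, ε, hε, h⟩ := exists_eq_update_of_sum_sq h1
    exact ⟨x, i, ε, hx, hε, rfl, h⟩
  choose! x i ε hx hε h1 h2 using h
  rw [← card_shadowLabels, ← Set.encard_coe_eq_coe_finsetCard]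
  refine Set.encard_le_encard_of_injOn
    (f := fun e => ⟨i e, ε e, Function.update (x e) (i e) 0⟩) ?_ ?_
  · intro e he
    simp only [shadowLabels, Finset.coe_sigma, Set.mem_sigma_iff, Finset.mem_coe,
      Finset.mem_product]
    exact ⟨Finset.mem_univ _, hε e he, Finset.mem_image_of_mem _ (hx e he)⟩
  · have hend : ∀ e ∈ edgeBoundary (toLattice '' (C : Set (Fin d → ℕ))), ∀ k : ℕ,
        (k : ℤ) = x e (i e) + ε e → Function.update (x e) (i e) k ∉ C := by
      intro e he k hk hmem
      refine he.2.2 ?_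
      rw [h2 e he, ← hk, ← toLattice_update]
      exact ⟨_, hmem, rfl⟩
    have hle : ∀ e ∈ edgeBoundary (toLattice '' (C : Set (Fin d → ℕ))),
        ∀ e' ∈ edgeBoundary (toLattice '' (C : Set (Fin d → ℕ))), i e = i e' → ε e = ε e' →
        Function.update (x e) (i e) 0 = Function.update (x e') (i e') 0 →
        x e' (i e') ≤ x e (i e) := by
      intro e he e' he' hi hee hu
      by_contra! hlt
      have hup : ∀ k, Function.update (x e) (i e) k = Function.update (x e') (i e') k := by
        intro k
        have := congrArg (fun f => Function.update f (i e) k) hu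
        simp only [Function.update_idem] at this
        rw [this, hi, Function.update_idem]
      have hε' := hε e he
      simp only [Finset.mem_insert, Finset.mem_singleton] at hε'
      rcases hε' with h | h
      · apply hend e he (x e (i e) + 1) (by rw [h]; push_cast; rfl)
        rw [hup]
        exact hdown _ (hx e' he') _ _ (by omega) (by omega)
      · have hp : 1 ≤ x e (i e) := hpos _ (hx e he) _
        apply hend e' he' (x e' (i e') - 1) (by rw [← hee, h]; omega)
        exact hdown _ (hx e' he') _ _ (by omega) (by omega)
    intro e he e' he' hee
    simp only [Sigma.mk.injEq, heq_eq_eq, Prod.mk.injEq] at hee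
    obtain ⟨h3, h4, h5⟩ := hee
    have h6 : x e (i e) = x e' (i e') :=
      le_antisymm (hle e' he' e he h3.symm h4.symm h5.symm) (hle e he e' he' h3 h4 h5)
    have h7 : x e = x e' := by
      have := congrArg (fun f => Function.update f (i e) (x e (i e))) h5
      simp only [Function.update_idem, Function.update_eq_self] at this
      rw [this, h6, h3, Function.update_idem, Function.update_eq_self]
    refine Prod.ext ?_ ?_
    · rw [h1 e he, h1 e' he', h7]
    · rw [h2 e he, h2 e' he', h7, h4, h3]

end Perimeter

/-! ### The order -/

section Order

variable {d : ℕ}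

theorem le_tupleMax {S : Finset (Fin d)} {x : Fin d → ℕ} {i : Fin d} (hi : i ∈ S) :
    x i ≤ tupleMax S x :=
  Finset.le_sup hi

theorem tupleMax_le {S : Finset (Fin d)} {x : Fin d → ℕ} {m : ℕ} (h : ∀ i ∈ S, x i ≤ m) :
    tupleMax S x ≤ m :=
  Finset.sup_le h

theorem tupleMax_eq {S : Finset (Fin d)} {x : Fin d → ℕ} {m : ℕ} {i : Fin d} (hi : i ∈ S)
    (hm : x i = m) (h : ∀ i ∈ S, x i ≤ m) : tupleMax S x = m :=
  le_antisymm (tupleMax_le h) (hm ▸ le_tupleMax hi)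

theorem RightLex.asymm {S : Finset (Fin d)} {x y : Fin d → ℕ} (h : RightLex S x y) :
    ¬ RightLex S y x := by
  rintro ⟨j, hj, hj1, hj2⟩
  obtain ⟨i, hi, hi1, hi2⟩ := h
  rcases lt_trichotomy i j with h | rfl | h
  · have := hi1 j hj h
    omega
  · omega
  · have := hj1 i hi h
    omega

theorem PrecOn.asymm {S : Finset (Fin d)} {x y : Fin d → ℕ} (h : PrecOn x y S) :
    ¬ PrecOn y x S := by
  induction h with
  | max_lt S hmax =>
    intro h
    cases h <;> omega
  | tilde_lt S hmax hlex =>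
    intro h
    cases h with
    | max_lt _ h => omega
    | tilde_lt _ _ h => exact hlex.asymm h
    | star_lt _ _ _ h _ =>
      obtain ⟨i, hi, _, hlt⟩ := hlex
      have := h i hi
      omega
  | star_lt S hmax htwo htilde hstar ih =>
    intro h
    cases h with
    | max_lt _ h => omega
    | tilde_lt _ _ h =>
      obtain ⟨i, hi, _, hlt⟩ := h
      have := htilde i hi
      omega
    | star_lt _ _ _ _ h =>
      apply ih
      -- Equal tilde tuples with equal maxima attain the maximum at the same indices, so both
      -- recursions drop the same entries.
      convert h using 1
      refine Finset.filter_congr fun i hi => ?_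
      have h1 := htilde i hi
      have h2 := le_tupleMax (x := x) hi
      have h3 := le_tupleMax (x := y) hi
      simp only [tupleTilde] at h1
      split_ifs at h1 <;> omega

/-- If the last index where `y` attains the common bound `m` is not one where `x` attains it, and `x`
stays below `m` from there on, then `x` precedes `y`. -/
theorem PrecOn.of_last {S : Finset (Fin d)} {x y : Fin d → ℕ} {m : ℕ} {i : Fin d}
    (hx : ∀ j ∈ S, 1 ≤ x j) (hxm : ∀ j ∈ S, x j ≤ m) (hym : ∀ j ∈ S, y j ≤ m) (hi : i ∈ S)
    (hyi : y i = m) (hxi : x i < m)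
    (hlast : ∀ j ∈ S, i < j → (x j < m ∧ y j < m) ∨ (x j = m ∧ y j = m)) : PrecOn x y S := by
  have hy : tupleMax S y = m := tupleMax_eq hi hyi hym
  rcases (tupleMax_le hxm).lt_or_eq with h | h
  · exact .max_lt S (by omega)
  refine .tilde_lt S (by omega) ⟨i, hi, fun j hj hij => ?_, ?_⟩
  · simp only [tupleTilde, h, hy]
    rcases hlast j hj hij with h | h
    · rw [if_pos h.1, if_pos h.2]
    · rw [if_neg (by omega), if_neg (by omega)]
      omega
  · simp only [tupleTilde, h, hy]
    rw [if_pos hxi, if_neg (by omega)]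
    have := hx i hi
    omega

theorem exists_last_eq {S : Finset (Fin d)} {y : Fin d → ℕ} {m : ℕ} {i : Fin d} (hi : i ∈ S)
    (hyi : y i = m) : ∃ l ∈ S, i ≤ l ∧ y l = m ∧ ∀ j ∈ S, l < j → y j ≠ m := by
  obtain ⟨l, hl, hmax⟩ := Finset.exists_max_image (S.filter fun j => y j = m) id
    ⟨i, Finset.mem_filter.2 ⟨hi, hyi⟩⟩
  rw [Finset.mem_filter] at hl
  refine ⟨l, hl.1, hmax i (Finset.mem_filter.2 ⟨hi, hyi⟩), hl.2, fun j hj hlj hym => ?_⟩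
  exact absurd (hmax j (Finset.mem_filter.2 ⟨hj, hym⟩)) (not_le.2 hlj)

/-- Common maximal entries at the same index can be dropped. -/
theorem PrecOn.of_erase {S : Finset (Fin d)} {x y : Fin d → ℕ} {m : ℕ} {t : Fin d} (ht : t ∈ S)
    (hx : ∀ j ∈ S, 1 ≤ x j) (hxm : ∀ j ∈ S, x j ≤ m) (hym : ∀ j ∈ S, y j ≤ m)
    (hxt : x t = m) (hyt : y t = m) (h : PrecOn x y (S.erase t)) : PrecOn x y S := by
  have hmx : tupleMax S x = m := tupleMax_eq ht hxt hxm
  have hmy : tupleMax S y = m := tupleMax_eq ht hyt hym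
  have hsplit : ∀ j ∈ S, j = t ∨ j ∈ S.erase t := fun j hj => by
    by_cases hjt : j = t
    · exact .inl hjt
    · exact .inr (Finset.mem_erase.2 ⟨hjt, hj⟩)
  have hμm : tupleMax (S.erase t) y ≤ m := tupleMax_le fun j hj => hym j (Finset.mem_of_mem_erase hj)
  -- If `t` is the only index where `m` is attained, the recursive clause drops exactly `t`.
  -- Otherwise `m` is still the maximum on `S.erase t`, at least for `y`.
  have small : tupleMax (S.erase t) x ≤ tupleMax (S.erase t) y → tupleMax (S.erase t) y < m →
      2 < m → PrecOn x y S := by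
    intro hxy hy hm
    have hlt : ∀ j ∈ S.erase t, x j < m ∧ y j < m := fun j hj =>
      ⟨(le_tupleMax hj).trans_lt (hxy.trans_lt hy), (le_tupleMax hj).trans_lt hy⟩
    refine .star_lt S (by omega) (by omega) (fun j hj => ?_) ?_
    · simp only [tupleTilde, hmx, hmy]
      rcases hsplit j hj with rfl | hj
      · rw [hxt, hyt]
      · rw [if_pos (hlt j hj).1, if_pos (hlt j hj).2]
    · convert h using 1
      ext j
      simp only [Finset.mem_filter, hmx]
      constructor
      · rintro ⟨hj, hlt⟩
        exact (hsplit j hj).resolve_left (by rintro rfl; omega)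
      · exact fun hj => ⟨Finset.mem_of_mem_erase hj, (hlt j hj).1⟩
  have hx' : ∀ j ∈ S.erase t, 1 ≤ x j := fun j hj => hx j (Finset.mem_of_mem_erase hj)
  cases h with
  | max_lt _ hmax =>
    rcases hμm.lt_or_eq with hμ | hμ
    · refine small hmax.le hμ ?_
      rcases (S.erase t).eq_empty_or_nonempty with he | ⟨j, hj⟩
      -- The maximum over the empty index set is `0`, so it cannot be strictly larger for `y`.
      · rw [he] at hmax
        simp [tupleMax] at hmax
      · have := hx' j hj
        have := le_tupleMax (x := x) hj
        omega
    · have hne : (S.erase t).Nonempty := by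
        rw [Finset.nonempty_iff_ne_empty]
        intro he
        rw [he] at hmax
        simp [tupleMax] at hmax
      obtain ⟨i, hi, hi'⟩ := Finset.exists_mem_eq_sup (S.erase t) hne y
      have hyi : y i = m := hi'.symm.trans hμ
      obtain ⟨l, hl, -, hyl, hlast⟩ := exists_last_eq hi hyi
      refine PrecOn.of_last hx hxm hym (Finset.mem_of_mem_erase hl) hyl
        ((le_tupleMax hl).trans_lt (by omega)) fun j hj hlj => ?_
      rcases hsplit j hj with rfl | hj'
      · exact .inr ⟨hxt, hyt⟩
      · have h1 := le_tupleMax (x := x) hj'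
        have h2 := hlast j hj' hlj
        have h3 := hym j hj
        left
        omega
  | tilde_lt _ hmax hlex =>
    obtain ⟨i, hi, heq, hlt⟩ := hlex
    rcases hμm.lt_or_eq with hμ | hμ
    · refine small hmax.le hμ ?_
      have h1 := hx' i hi
      have h2 := le_tupleMax (x := y) hi
      simp only [tupleTilde] at hlt
      split_ifs at hlt <;> omega
    · refine .tilde_lt S (by omega) ⟨i, Finset.mem_of_mem_erase hi, fun j hj hij => ?_, ?_⟩
      · rcases hsplit j hj with rfl | hj'
        · simp [tupleTilde, hmx, hmy, hxt, hyt]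
        · have := heq j hj' hij
          simpa only [tupleTilde, hmx, hmy, hmax, hμ] using this
      · simpa only [tupleTilde, hmx, hmy, hmax, hμ] using hlt
  | star_lt _ hmax htwo htilde hstar =>
    rcases hμm.lt_or_eq with hμ | hμ
    · exact small hmax.le hμ (by omega)
    · refine .star_lt S (by omega) (by omega) (fun j hj => ?_) ?_
      · rcases hsplit j hj with rfl | hj'
        · simp [tupleTilde, hmx, hmy, hxt, hyt]
        · have := htilde j hj'
          simpa only [tupleTilde, hmx, hmy, hmax, hμ] using this
      · convert hstar using 1
        ext j
        simp only [Finset.mem_filter, hmx, hmax, hμ, Finset.mem_erase]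
        constructor
        · rintro ⟨hj, hlt⟩
          exact ⟨⟨by rintro rfl; omega, hj⟩, hlt⟩
        · exact fun ⟨hj, hlt⟩ => ⟨hj.2, hlt⟩

/-- Equal finite cardinalities give a point in each difference, and each would precede the other.
Asymmetry alone is needed. -/
theorem IsFirstString.unique {n : ℕ} {F F' : Set (Fin d → ℕ)} (h : IsFirstString n F)
    (h' : IsFirstString n F') : F = F' := by
  obtain ⟨hp, hc, hf⟩ := h
  obtain ⟨hp', hc', hf'⟩ := h'
  have hfin : F.Finite := Set.finite_of_encard_eq_coe hc
  have hfin' : F'.Finite := Set.finite_of_encard_eq_coe hc'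
  by_contra hne
  obtain ⟨x, hx, hxn⟩ : ∃ x ∈ F, x ∉ F' := by
    by_contra! hsub
    exact hne (hfin'.eq_of_subset_of_encard_le' hsub (by rw [hc, hc']))
  obtain ⟨y, hy, hyn⟩ : ∃ y ∈ F', y ∉ F := by
    by_contra! hsub
    exact hne (hfin.eq_of_subset_of_encard_le' hsub (by rw [hc, hc'])).symm
  exact (hf x hx y (hp' y hy) hyn).asymm (hf' y hy x (hp x hx) hxn)

end Order

/-! ### Daisies, recursively -/

section Daisy

variable {d : ℕ}

/-- The tuple of oscillation at most one with values `c + 1` before `t` and `c` from `t` on. -/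
def stepTuple (c : ℕ) (t : Fin d) : Fin d → ℕ :=
  fun j => if j < t then c + 1 else c

/-- The box with sides `q j`, `j ∈ S`, in the coordinate plane through `z` with directions `S`. -/
def boxOn (S : Finset (Fin d)) (z q : Fin d → ℕ) : Finset (Fin d → ℕ) :=
  Fintype.piFinset fun j => if j ∈ S then Finset.Icc 1 (q j) else {z j}

/-- Daisies in the coordinate plane through `z` with directions `S`, the sides of the largest box
being given by `stepTuple c t`. -/
inductive DaisyOn : Finset (Fin d) → (Fin d → ℕ) → ℕ → Fin d → Finset (Fin d → ℕ) → Prop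
  | box (S : Finset (Fin d)) (z : Fin d → ℕ) (c : ℕ) (t : Fin d) (ht : t ∈ S) (hc : 1 ≤ c) :
      DaisyOn S z c t (boxOn S z (stepTuple c t))
  | cons (S : Finset (Fin d)) (z : Fin d → ℕ) (c : ℕ) (t : Fin d) (ht : t ∈ S) (hc : 1 ≤ c)
      (c' : ℕ) (t' : Fin d) (C : Finset (Fin d → ℕ))
      (hC : DaisyOn (S.erase t) (Function.update z t (c + 1)) c' t' C)
      (hle : ∀ j ∈ S.erase t, stepTuple c' t' j ≤ stepTuple c t j)
      (hlt : ∃ j ∈ S.erase t, stepTuple c' t' j < stepTuple c t j) :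
      DaisyOn S z c t (boxOn S z (stepTuple c t) ∪ C)

theorem mem_boxOn {S : Finset (Fin d)} {z q x : Fin d → ℕ} :
    x ∈ boxOn S z q ↔ (∀ j ∈ S, 1 ≤ x j ∧ x j ≤ q j) ∧ ∀ j ∉ S, x j = z j := by
  rw [boxOn, Fintype.mem_piFinset]
  refine ⟨fun h => ⟨fun j hj => ?_, fun j hj => ?_⟩, fun h j => ?_⟩
  · simpa [hj] using h j
  · simpa [hj] using h j
  · by_cases hj : j ∈ S
    · simpa [hj] using h.1 j hj
    · simpa [hj] using h.2 j hj

theorem card_boxOn (S : Finset (Fin d)) (z q : Fin d → ℕ) :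
    (boxOn S z q).card = ∏ j ∈ S, q j := by
  rw [boxOn, Fintype.card_piFinset, ← Finset.prod_subset (Finset.subset_univ S)]
  · refine Finset.prod_congr rfl fun j hj => ?_
    simp [hj]
  · intro j _ hj
    simp [hj]

theorem stepTuple_self (c : ℕ) (t : Fin d) : stepTuple c t t = c := by
  simp [stepTuple]

theorem le_stepTuple (c : ℕ) (t j : Fin d) : c ≤ stepTuple c t j := by
  unfold stepTuple
  split_ifs <;> omega

theorem stepTuple_le (c : ℕ) (t j : Fin d) : stepTuple c t j ≤ c + 1 := by
  unfold stepTuple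
  split_ifs <;> omega

theorem stepTuple_of_le {c : ℕ} {t j : Fin d} (h : t ≤ j) : stepTuple c t j = c :=
  if_neg (not_lt.2 h)

theorem stepTuple_of_lt {c : ℕ} {t j : Fin d} (h : j < t) : stepTuple c t j = c + 1 :=
  if_pos h

theorem stepTuple_antitone (c : ℕ) (t : Fin d) : Antitone (stepTuple c t) := by
  intro i j hij
  by_cases h : j < t
  · rw [stepTuple_of_lt h, stepTuple_of_lt (hij.trans_lt h)]
  · rw [stepTuple_of_le (not_lt.1 h)]
    exact le_stepTuple c t i

/-- The tuples form a chain, ordered by `c` and then by `t`; this later turns a comparison of box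
sizes into an entrywise one. -/
theorem stepTuple_le_total (c c' : ℕ) (t t' : Fin d) :
    (∀ j, stepTuple c t j ≤ stepTuple c' t' j) ∨ ∀ j, stepTuple c' t' j ≤ stepTuple c t j := by
  have key : ∀ (c : ℕ) (t t' : Fin d), t ≤ t' → ∀ j, stepTuple c t j ≤ stepTuple c t' j := by
    intro c t t' h j
    by_cases hj : j < t
    · rw [stepTuple_of_lt hj, stepTuple_of_lt (hj.trans_le h)]
    · rw [stepTuple_of_le (not_lt.1 hj)]
      exact le_stepTuple c t' j
  rcases lt_trichotomy c c' with h | rfl | h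
  · exact .inl fun j => (stepTuple_le c t j).trans (Nat.succ_le_of_lt h |>.trans (le_stepTuple c' t' j))
  · rcases le_total t t' with h | h
    · exact .inl (key c t t' h)
    · exact .inr (key c t' t h)
  · exact .inr fun j => (stepTuple_le c' t' j).trans (Nat.succ_le_of_lt h |>.trans (le_stepTuple c t j))

/-- A daisy can exceed its largest box by one at the position `t'`; this leaves room for that extra
unit in a larger box. If it failed, the tuple with primes would dominate everywhere. -/
theorem stepTuple_lt_of_lt {S : Finset (Fin d)} {c c' : ℕ} {t t' : Fin d}
    (hlt : ∃ j ∈ S, stepTuple c' t' j < stepTuple c t j) : c' < stepTuple c t t' := by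
  by_contra! h
  obtain ⟨i, hi, hi'⟩ := hlt
  rcases lt_or_ge i t' with hit | hit
  · rw [stepTuple_of_lt hit] at hi'
    have h1 := stepTuple_le c t i
    have h2 := le_stepTuple c t t'
    omega
  · rw [stepTuple_of_le hit] at hi'
    have := stepTuple_antitone c t hit
    omega

theorem DaisyOn.box_subset {S : Finset (Fin d)} {z : Fin d → ℕ} {c : ℕ} {t : Fin d}
    {C : Finset (Fin d → ℕ)} (h : DaisyOn S z c t C) : boxOn S z (stepTuple c t) ⊆ C := by
  cases h
  · exact subset_rfl
  · exact Finset.subset_union_left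

theorem DaisyOn.bound {S : Finset (Fin d)} {z : Fin d → ℕ} {c : ℕ} {t : Fin d}
    {C : Finset (Fin d → ℕ)} (h : DaisyOn S z c t C) : ∀ x ∈ C,
      (∀ j ∈ S, 1 ≤ x j ∧ x j ≤ stepTuple c t j + if j = t then 1 else 0) ∧ ∀ j ∉ S, x j = z j := by
  induction h with
  | box S z c t ht hc =>
    intro x hx
    rw [mem_boxOn] at hx
    exact ⟨fun j hj => ⟨(hx.1 j hj).1, (hx.1 j hj).2.trans (Nat.le_add_right _ _)⟩, hx.2⟩
  | cons S z c t ht hc c' t' C hC hle hlt ih =>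
    intro x hx
    rcases Finset.mem_union.1 hx with hx | hx
    · rw [mem_boxOn] at hx
      exact ⟨fun j hj => ⟨(hx.1 j hj).1, (hx.1 j hj).2.trans (Nat.le_add_right _ _)⟩, hx.2⟩
    obtain ⟨h1, h2⟩ := ih x hx
    refine ⟨fun j hj => ?_, fun j hj => ?_⟩
    · by_cases hjt : j = t
      · subst hjt
        have := h2 j (by simp)
        rw [Function.update_self] at this
        rw [this, stepTuple_self, if_pos rfl]
        omega
      · have hj' := Finset.mem_erase.2 ⟨hjt, hj⟩
        have h3 := h1 j hj'
        have h4 := hle j hj'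
        rw [if_neg hjt]
        by_cases hjt' : j = t'
        · subst hjt'
          have := stepTuple_lt_of_lt hlt
          rw [if_pos rfl, stepTuple_self] at h3
          omega
        · rw [if_neg hjt'] at h3
          omega
    · have hjt : j ≠ t := by rintro rfl; exact hj ht
      rw [h2 j fun h => hj (Finset.mem_of_mem_erase h), Function.update_of_ne hjt]

theorem DaisyOn.subset_boxOn {S : Finset (Fin d)} {z : Fin d → ℕ} {c c' : ℕ} {t t' : Fin d}
    {C : Finset (Fin d → ℕ)} (h : DaisyOn S z c' t' C)
    (hle : ∀ j ∈ S, stepTuple c' t' j ≤ stepTuple c t j)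
    (hlt : ∃ j ∈ S, stepTuple c' t' j < stepTuple c t j) :
    C ⊆ boxOn S z (stepTuple c t) := by
  intro x hx
  obtain ⟨h1, h2⟩ := h.bound x hx
  refine mem_boxOn.2 ⟨fun j hj => ⟨(h1 j hj).1, ?_⟩, h2⟩
  have h3 := h1 j hj
  have h4 := hle j hj
  by_cases hjt : j = t'
  · subst hjt
    have := stepTuple_lt_of_lt hlt
    rw [if_pos rfl, stepTuple_self] at h3
    omega
  · rw [if_neg hjt] at h3
    omega

theorem DaisyOn.precOn {S : Finset (Fin d)} {z : Fin d → ℕ} {c : ℕ} {t : Fin d}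
    {C : Finset (Fin d → ℕ)} (h : DaisyOn S z c t C) : ∀ x ∈ C, ∀ y : Fin d → ℕ,
      (∀ j ∈ S, 1 ≤ y j) → (∀ j ∉ S, y j = z j) → y ∉ C → PrecOn x y S := by
  -- This settles every comparison except that of two points with the common maximal entry `c + 1`
  -- at `t`, which is deferred to the last hypothesis. From `t` on, `x` can reach `c + 1` only at
  -- `t` itself.
  have key : ∀ (S : Finset (Fin d)) (z : Fin d → ℕ) (c : ℕ) (t : Fin d), t ∈ S → 1 ≤ c →
      ∀ x y : Fin d → ℕ, (∀ j ∈ S, 1 ≤ x j) →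
      (∀ j ∈ S, x j ≤ stepTuple c t j + if j = t then 1 else 0) →
      (∀ j ∈ S, 1 ≤ y j) → (∀ j ∉ S, y j = z j) → y ∉ boxOn S z (stepTuple c t) →
      (x t = c + 1 → y t = c + 1 → (∀ j ∈ S, y j ≤ c + 1) → PrecOn x y S) → PrecOn x y S := by
    intro S z c t ht hc x y hx hxc hy hyz hyn hrec
    have hxm : ∀ j ∈ S, x j ≤ c + 1 := by
      intro j hj
      have := hxc j hj
      by_cases hjt : j = t
      · subst hjt
        rwa [stepTuple_self, if_pos rfl] at this
      · rw [if_neg hjt] at this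
        exact this.trans (stepTuple_le c t j)
    by_cases hym : ∀ j ∈ S, y j ≤ c + 1
    · obtain ⟨i, hi, hiy⟩ : ∃ i ∈ S, stepTuple c t i < y i := by
        by_contra! hall
        exact hyn (mem_boxOn.2 ⟨fun j hj => ⟨hy j hj, hall j hj⟩, hyz⟩)
      have hti : t ≤ i := by
        by_contra! hlt
        rw [stepTuple_of_lt hlt] at hiy
        have := hym i hi
        omega
      have hyi : y i = c + 1 := by
        rw [stepTuple_of_le hti] at hiy
        have := hym i hi
        omega
      obtain ⟨l, hl, hil, hyl, hlast⟩ := exists_last_eq hi hyi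
      by_cases hxl : x l = c + 1
      · have hlt : l = t := by
          by_contra hne
          have := hxc l hl
          rw [if_neg hne, stepTuple_of_le (hti.trans hil)] at this
          omega
        subst hlt
        exact hrec hxl hyl hym
      · refine PrecOn.of_last hx hxm hym hl hyl (by have := hxm l hl; omega) fun j hj hlj => .inl ?_
        have htj : t < j := (hti.trans hil).trans_lt hlj
        have h1 := hxc j hj
        rw [if_neg htj.ne', stepTuple_of_le htj.le] at h1
        have h2 := hlast j hj hlj
        have h3 := hym j hj
        omega
    · push Not at hym
      obtain ⟨i, hi, hiy⟩ := hym
      have h1 := tupleMax_le hxm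
      have h2 := le_tupleMax (x := y) hi
      exact .max_lt S (by omega)
  induction h with
  | box S z c t ht hc =>
    intro x hx y hy hyz hyn
    rw [mem_boxOn] at hx
    refine key S z c t ht hc x y (fun j hj => (hx.1 j hj).1)
      (fun j hj => (hx.1 j hj).2.trans (Nat.le_add_right _ _)) hy hyz hyn fun h _ _ => ?_
    have := (hx.1 t ht).2
    rw [stepTuple_self] at this
    omega
  | cons S z c t ht hc c' t' C hC hle hlt ih =>
    intro x hx y hy hyz hyn
    rw [Finset.mem_union, not_or] at hyn
    have hb := (DaisyOn.cons S z c t ht hc c' t' C hC hle hlt).bound x hx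
    refine key S z c t ht hc x y (fun j hj => (hb.1 j hj).1) (fun j hj => (hb.1 j hj).2) hy hyz
      hyn.1 fun hxt hyt hym => ?_
    rcases Finset.mem_union.1 hx with hx | hx
    · have := ((mem_boxOn.1 hx).1 t ht).2
      rw [stepTuple_self] at this
      omega
    refine PrecOn.of_erase ht (fun j hj => (hb.1 j hj).1) (fun j hj => ?_) hym hxt hyt
      (ih x hx y (fun j hj => hy j (Finset.mem_of_mem_erase hj)) (fun j hj => ?_) hyn.2)
    · have := (hb.1 j hj).2
      by_cases hjt : j = t
      · subst hjt
        omega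
      · rw [if_neg hjt] at this
        exact this.trans (stepTuple_le c t j)
    · by_cases hjt : j = t
      · subst hjt
        rw [hyt, Function.update_self]
      · rw [Function.update_of_ne hjt]
        exact hyz j fun h => hj (Finset.mem_erase.2 ⟨hjt, h⟩)

theorem DaisyOn.update_mem {S : Finset (Fin d)} {z : Fin d → ℕ} {c : ℕ} {t : Fin d}
    {C : Finset (Fin d → ℕ)} (h : DaisyOn S z c t C) : ∀ x ∈ C, ∀ i ∈ S, ∀ k, 1 ≤ k → k ≤ x i →
      Function.update x i k ∈ C := by
  have key : ∀ (S : Finset (Fin d)) (z q x : Fin d → ℕ) (i : Fin d) (k : ℕ), i ∈ S →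
      (∀ j ∈ S, j ≠ i → 1 ≤ x j ∧ x j ≤ q j) → (∀ j ∉ S, x j = z j) → 1 ≤ k → k ≤ q i →
      Function.update x i k ∈ boxOn S z q := by
    intro S z q x i k hi hx hz hk hkq
    refine mem_boxOn.2 ⟨fun j hj => ?_, fun j hj => ?_⟩
    · by_cases hji : j = i
      · subst hji
        rw [Function.update_self]
        exact ⟨hk, hkq⟩
      · rw [Function.update_of_ne hji]
        exact hx j hj hji
    · rw [Function.update_of_ne (by rintro rfl; exact hj hi)]
      exact hz j hj
  induction h with
  | box S z c t ht hc =>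
    intro x hx i hi k hk hkx
    rw [mem_boxOn] at hx
    exact key S z _ x i k hi (fun j hj _ => hx.1 j hj) hx.2 hk (hkx.trans (hx.1 i hi).2)
  | cons S z c t ht hc c' t' C hC hle hlt ih =>
    intro x hx i hi k hk hkx
    have hb := (DaisyOn.cons S z c t ht hc c' t' C hC hle hlt).bound x hx
    rcases Finset.mem_union.1 hx with hx' | hx'
    · rw [mem_boxOn] at hx'
      exact Finset.mem_union_left _
        (key S z _ x i k hi (fun j hj _ => hx'.1 j hj) hx'.2 hk (hkx.trans (hx'.1 i hi).2))
    by_cases hit : i = t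
    · subst hit
      have hxi : x i = c + 1 := by
        have := (hC.bound x hx').2 i (by simp)
        rwa [Function.update_self] at this
      rcases hkx.lt_or_eq with hlt' | rfl
      -- Lowering the entry `c + 1` at `t` lands in the largest box, as all other coordinates are
      -- within its sides.
      · refine Finset.mem_union_left _ (key S z _ x i k hi (fun j hj hji => ?_) hb.2 hk ?_)
        · have := hb.1 j hj
          rwa [if_neg hji] at this
        · rw [stepTuple_self]
          omega
      · rw [Function.update_eq_self]
        exact Finset.mem_union_right _ hx'
    · exact Finset.mem_union_right _ (ih x hx' i (Finset.mem_erase.2 ⟨hit, hi⟩) k hk hkx)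

end Daisy

/-! ### Daisies of every cardinality, and their shadows -/

section DaisyCard

variable {d : ℕ}

theorem prod_stepTuple (S : Finset (Fin d)) (q : ℕ) (t : Fin d) :
    ∏ j ∈ S, stepTuple (q + 1) t j = boxSize S.card (S.card * q + (S.filter (· < t)).card) := by
  have hadd := Finset.card_filter_add_card_filter_not (s := S) (· < t)
  rw [boxSize_mul_add q (by omega)]
  simp only [stepTuple]
  rw [Finset.prod_ite, Finset.prod_const, Finset.prod_const]
  congr 2
  omega

theorem card_filter_lt_erase (S : Finset (Fin d)) (t : Fin d) :
    ((S.erase t).filter (· < t)).card = (S.filter (· < t)).card := by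
  congr 1
  ext j
  simp only [Finset.mem_filter, Finset.mem_erase]
  exact ⟨fun h => ⟨h.1.2, h.2⟩, fun h => ⟨⟨h.2.ne, h.1⟩, h.2⟩⟩

theorem card_filter_lt_lt {S : Finset (Fin d)} {t : Fin d} (ht : t ∈ S) :
    (S.filter (· < t)).card < S.card :=
  Finset.card_lt_card (Finset.filter_ssubset.2 ⟨t, ht, lt_irrefl t⟩)

theorem exists_card_filter_lt_eq {S : Finset (Fin d)} {a : ℕ} (ha : a < S.card) :
    ∃ t ∈ S, (S.filter (· < t)).card = a := by
  refine ⟨S.orderEmbOfFin rfl ⟨a, ha⟩, S.orderEmbOfFin_mem rfl _, ?_⟩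
  have h : S.filter (· < S.orderEmbOfFin rfl ⟨a, ha⟩) =
      (Finset.univ.filter fun i : Fin S.card => i < ⟨a, ha⟩).map
        (S.orderEmbOfFin rfl).toEmbedding := by
    ext j
    simp only [Finset.mem_filter, Finset.mem_map, Finset.mem_univ, true_and]
    constructor
    · rintro ⟨hj, hlt⟩
      have : j ∈ Set.range (S.orderEmbOfFin rfl) := by
        rw [Finset.range_orderEmbOfFin]
        exact hj
      obtain ⟨i, rfl⟩ := this
      exact ⟨i, (S.orderEmbOfFin rfl).lt_iff_lt.1 hlt, rfl⟩
    · rintro ⟨i, hi, rfl⟩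
      exact ⟨S.orderEmbOfFin_mem rfl _, (S.orderEmbOfFin rfl).lt_iff_lt.2 hi⟩
  rw [h, Finset.card_map]
  have : (Finset.univ.filter fun i : Fin S.card => i < ⟨a, ha⟩) = Finset.Iio ⟨a, ha⟩ := by
    ext; simp
  rw [this, Fin.card_Iio]

theorem DaisyOn.card_union {S : Finset (Fin d)} {z : Fin d → ℕ} {c c' : ℕ} {t t' : Fin d}
    {C : Finset (Fin d → ℕ)} (ht : t ∈ S)
    (h : DaisyOn (S.erase t) (Function.update z t (c + 1)) c' t' C) :
    (boxOn S z (stepTuple c t) ∪ C).card = ∏ j ∈ S, stepTuple c t j + C.card := by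
  rw [Finset.card_union_of_disjoint, card_boxOn]
  rw [Finset.disjoint_left]
  intro x hx hx'
  have h1 := ((mem_boxOn.1 hx).1 t ht).2
  have h2 := (h.bound x hx').2 t (by simp)
  rw [Function.update_self] at h2
  rw [stepTuple_self] at h1
  omega

theorem exists_daisyOn_card (S : Finset (Fin d)) (hS : S.Nonempty) (z : Fin d → ℕ) (n : ℕ)
    (hn : 1 ≤ n) : ∃ c t C, DaisyOn S z c t C ∧ C.card = n := by
  induction hD : S.card generalizing S z n with
  | zero => exact absurd hD hS.card_pos.ne'
  | succ D ih =>
    obtain ⟨u, r, hr, rfl⟩ := exists_boxSize_add (D := D) (n := n) (by omega)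
    obtain ⟨q, a, ha, rfl⟩ := exists_eq_mul_add D u
    -- The box of index `(D + 1) * q + a` has `a` long sides, so the value changes at the element of
    -- `S` with `a` predecessors.
    obtain ⟨t, ht, hta⟩ := exists_card_filter_lt_eq (S := S) (a := a) (by omega)
    have hbox : ∏ j ∈ S, stepTuple (q + 1) t j = boxSize (D + 1) ((D + 1) * q + a) := by
      rw [prod_stepTuple, hta, hD]
    have hcard : (S.erase t).card = D := by
      rw [Finset.card_erase_of_mem ht, hD]
      rfl
    have hfacet : ∏ j ∈ S.erase t, stepTuple (q + 1) t j = boxSize D (D * q + a) := by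
      rw [prod_stepTuple, card_filter_lt_erase, hta, hcard]
    rw [facetIndex_mul_add q ha, ← hfacet] at hr
    rcases Nat.eq_zero_or_pos r with rfl | hr0
    · exact ⟨q + 1, t, _, .box S z (q + 1) t ht (by omega), by rw [card_boxOn, hbox, add_zero]⟩
    have hne : (S.erase t).Nonempty := by
      rw [Finset.nonempty_iff_ne_empty]
      intro he
      rw [he, Finset.prod_empty] at hr
      omega
    obtain ⟨c', t', C, hC, hCr⟩ := ih (S.erase t) hne (Function.update z t (q + 1 + 1)) r hr0 hcard
    have hprod : ∏ j ∈ S.erase t, stepTuple c' t' j < ∏ j ∈ S.erase t, stepTuple (q + 1) t j := by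
      refine lt_of_le_of_lt ?_ hr
      rw [← hCr, ← card_boxOn (S.erase t) (Function.update z t (q + 1 + 1))]
      exact Finset.card_le_card hC.box_subset
    have hlt : ∃ j ∈ S.erase t, stepTuple c' t' j < stepTuple (q + 1) t j := by
      by_contra! hall
      exact absurd hprod (not_lt.2 (Finset.prod_le_prod' hall))
    have hle : ∀ j ∈ S.erase t, stepTuple c' t' j ≤ stepTuple (q + 1) t j := by
      rcases stepTuple_le_total c' (q + 1) t' t with h | h
      · exact fun j _ => h j
      · obtain ⟨j, _, hj⟩ := hlt
        exact absurd (h j) (not_le.2 hj)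
    exact ⟨q + 1, t, _, .cons S z (q + 1) t ht (by omega) c' t' C hC hle hlt,
      by rw [hC.card_union ht, hbox, hCr]⟩

theorem shadowSum_boxOn_le (S : Finset (Fin d)) (z q : Fin d → ℕ) :
    shadowSum S (boxOn S z q) ≤ ∑ i ∈ S, ∏ j ∈ S.erase i, q j := by
  refine Finset.sum_le_sum fun i hi => ?_
  rw [← card_boxOn (S.erase i) (Function.update z i 0)]
  refine Finset.card_le_card fun p hp => ?_
  obtain ⟨x, hx, rfl⟩ := Finset.mem_image.1 hp
  rw [mem_boxOn] at hx
  refine mem_boxOn.2 ⟨fun j hj => ?_, fun j hj => ?_⟩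
  · rw [Function.update_of_ne (Finset.ne_of_mem_erase hj)]
    exact hx.1 j (Finset.mem_of_mem_erase hj)
  · by_cases hji : j = i
    · subst hji
      simp
    · rw [Function.update_of_ne hji, Function.update_of_ne hji]
      exact hx.2 j fun h => hj (Finset.mem_erase.2 ⟨hji, h⟩)

/-- The facet sizes of a nearly cubical box add up to the closed form of `minShadow`. -/
theorem sum_prod_erase_stepTuple (S : Finset (Fin d)) (q : ℕ) (t : Fin d) :
    ∑ i ∈ S, ∏ j ∈ S.erase i, stepTuple (q + 1) t j =
      minShadow S.card (∏ j ∈ S, stepTuple (q + 1) t j) := by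
  have hadd := Finset.card_filter_add_card_filter_not (s := S) (· < t)
  apply Nat.eq_of_mul_eq_mul_left (show 0 < (q + 1) * (q + 2) by positivity)
  rw [prod_stepTuple, minShadow_boxSize_closed S.card q (by omega), ← prod_stepTuple,
    Finset.mul_sum]
  calc ∑ i ∈ S, (q + 1) * (q + 2) * ∏ j ∈ S.erase i, stepTuple (q + 1) t j
      = ∑ i ∈ S, (∏ j ∈ S, stepTuple (q + 1) t j) * if i < t then q + 1 else q + 2 := by
        refine Finset.sum_congr rfl fun i hi => ?_
        rw [← Finset.mul_prod_erase S _ hi]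
        by_cases h : i < t
        · rw [if_pos h, stepTuple_of_lt h]
          ring
        · rw [if_neg h, stepTuple_of_le (not_lt.1 h)]
          ring
    _ = _ := by
        rw [← Finset.mul_sum, Finset.sum_ite, Finset.sum_const, Finset.sum_const, smul_eq_mul,
          smul_eq_mul]
        congr 3
        omega

theorem shadowSum_union_le {S : Finset (Fin d)} {B C : Finset (Fin d → ℕ)} {t : Fin d} (ht : t ∈ S)
    (h : (C.image fun x => Function.update x t 0) ⊆ B.image fun x => Function.update x t 0) :
    shadowSum S (B ∪ C) ≤ shadowSum S B + shadowSum (S.erase t) C := by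
  unfold shadowSum
  rw [← Finset.add_sum_erase S _ ht, ← Finset.add_sum_erase S _ ht, add_assoc,
    ← Finset.sum_add_distrib]
  refine add_le_add ?_ (Finset.sum_le_sum fun j _ => ?_)
  · rw [Finset.image_union, Finset.union_eq_left.2 h]
  · rw [Finset.image_union]
    exact Finset.card_union_le _ _

/-- The smaller daisy sits over a facet of the box, so along `t` it adds no projection point; the
sum then follows the recursion of `minShadow`. -/
theorem DaisyOn.shadowSum_le {S : Finset (Fin d)} {z : Fin d → ℕ} {c : ℕ} {t : Fin d}
    {C : Finset (Fin d → ℕ)} (h : DaisyOn S z c t C) :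
    shadowSum S C ≤ minShadow S.card C.card := by
  induction h with
  | box S z c t ht hc =>
    obtain ⟨q, rfl⟩ := Nat.exists_eq_add_of_le' hc
    refine (shadowSum_boxOn_le _ _ _).trans ?_
    rw [sum_prod_erase_stepTuple, card_boxOn]
  | cons S z c t ht hc c' t' C hC hle hlt ih =>
    have hsub := hC.subset_boxOn hle hlt
    obtain ⟨q, rfl⟩ := Nat.exists_eq_add_of_le' hc
    have hadd : (S.erase t).card + 1 = S.card := Finset.card_erase_add_one ht
    have ha := card_filter_lt_lt ht
    have hcard : C.card ≤ boxSize (S.erase t).card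
        (facetIndex (S.erase t).card (S.card * q + (S.filter (· < t)).card)) := by
      refine (Finset.card_le_card hsub).trans ?_
      rw [card_boxOn, prod_stepTuple, card_filter_lt_erase, ← hadd, facetIndex_mul_add q (by omega)]
    have himage : (C.image fun x => Function.update x t 0) ⊆
        (boxOn S z (stepTuple (q + 1) t)).image fun x => Function.update x t 0 := by
      intro p hp
      obtain ⟨x, hx, rfl⟩ := Finset.mem_image.1 hp
      refine Finset.mem_image.2 ⟨Function.update x t 1, mem_boxOn.2 ⟨fun j hj => ?_, fun j hj => ?_⟩,
        Function.update_idem _ _ _⟩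
      · by_cases hjt : j = t
        · subst hjt
          rw [Function.update_self, stepTuple_self]
          omega
        · rw [Function.update_of_ne hjt]
          exact (mem_boxOn.1 (hsub hx)).1 j (Finset.mem_erase.2 ⟨hjt, hj⟩)
      · have hjt : j ≠ t := by rintro rfl; exact hj ht
        rw [Function.update_of_ne hjt,
          (mem_boxOn.1 (hsub hx)).2 j fun h => hj (Finset.mem_of_mem_erase h),
          Function.update_of_ne hjt]
    refine (shadowSum_union_le ht himage).trans ?_
    rw [hC.card_union ht, prod_stepTuple]
    have h1 := shadowSum_boxOn_le S z (stepTuple (q + 1) t)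
    rw [sum_prod_erase_stepTuple, prod_stepTuple] at h1
    rw [← hadd] at h1 hcard ⊢
    rw [minShadow_add hcard]
    exact add_le_add h1 ih

end DaisyCard

/-! ### Daisy data -/

section Data

variable {d : ℕ}

theorem isDO1On_stepTuple {S : Finset (Fin d)} {c : ℕ} {t : Fin d} (hc : 1 ≤ c) :
    IsDO1On S (stepTuple c t) := by
  refine ⟨fun i _ => hc.trans (le_stepTuple c t i), fun i _ j _ hij => stepTuple_antitone c t hij.le,
    fun i hi j hj hmin _ => ?_⟩
  have h1 := stepTuple_antitone c t (hmin j hj)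
  have h2 := stepTuple_le c t i
  have h3 := le_stepTuple c t j
  omega

theorem exists_isPredIn {S : Finset (Fin d)} {i t : Fin d} (hi : i ∈ S) (hit : i < t) :
    ∃ l, IsPredIn S l t ∧ i ≤ l := by
  obtain ⟨l, hl, hmax⟩ := Finset.exists_max_image (S.filter (· < t)) id
    ⟨i, Finset.mem_filter.2 ⟨hi, hit⟩⟩
  rw [Finset.mem_filter] at hl
  exact ⟨l, ⟨hl, fun j hj => hmax j (Finset.mem_filter.2 hj)⟩,
    hmax i (Finset.mem_filter.2 ⟨hi, hit⟩)⟩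

theorem isValueChange_stepTuple {S : Finset (Fin d)} {c : ℕ} {t : Fin d} (ht : t ∈ S) :
    IsValueChange S (stepTuple c t) t := by
  by_cases h : ∃ i ∈ S, i < t
  · obtain ⟨i, hi, hit⟩ := h
    right
    refine ⟨fun hall => ?_, ⟨ht, ?_⟩, ?_⟩
    · have := hall i hi t ht
      rw [stepTuple_of_lt hit, stepTuple_self] at this
      omega
    · obtain ⟨l, hl, -⟩ := exists_isPredIn hi hit
      refine ⟨l, hl, ?_⟩
      rw [stepTuple_self, stepTuple_of_lt hl.1.2]
      omega
    · rintro j ⟨hj, l, hl, hjl⟩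
      by_contra! hlt
      rw [stepTuple_of_lt hlt, stepTuple_of_lt (hl.1.2.trans hlt)] at hjl
      omega
  · push Not at h
    left
    refine ⟨fun i hi j hj => ?_, ht, fun j hj => h j hj⟩
    rw [stepTuple_of_le (h i hi), stepTuple_of_le (h j hj)]

/-- In the nonconstant case `t` is the first index with the smaller value; for a constant tuple it
is the first index of `S`. Either way `t` is the value-change position. -/
theorem IsDO1On.exists_eq_stepTuple {S : Finset (Fin d)} {q : Fin d → ℕ} (hS : S.Nonempty)
    (h : IsDO1On S q) : ∃ c t, t ∈ S ∧ 1 ≤ c ∧ ∀ j ∈ S, q j = stepTuple c t j := by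
  obtain ⟨hpos, hmono, hosc⟩ := h
  have hmin := S.min'_mem hS
  have hmax := S.max'_mem hS
  have hanti : ∀ i ∈ S, ∀ j ∈ S, i ≤ j → q j ≤ q i := by
    intro i hi j hj hij
    rcases hij.lt_or_eq with h | rfl
    · exact hmono i hi j hj h
    · exact le_rfl
  have hle : ∀ j ∈ S, q j ≤ q (S.min' hS) := fun j hj => hanti _ hmin j hj (S.min'_le j hj)
  have hge : ∀ j ∈ S, q (S.max' hS) ≤ q j := fun j hj => hanti j hj _ hmax (S.le_max' j hj)
  rcases hosc _ hmin _ hmax (fun i hi => S.min'_le i hi) (fun i hi => S.le_max' i hi) with h | h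
  · refine ⟨q (S.max' hS), S.min' hS, hmin, hpos _ hmax, fun j hj => ?_⟩
    rw [stepTuple_of_le (S.min'_le j hj)]
    have := hle j hj
    have := hge j hj
    omega
  · obtain ⟨t, ht, htmin⟩ := Finset.exists_min_image (S.filter fun j => q j = q (S.max' hS)) id
      ⟨_, Finset.mem_filter.2 ⟨hmax, rfl⟩⟩
    rw [Finset.mem_filter] at ht
    refine ⟨q (S.max' hS), t, ht.1, hpos _ hmax, fun j hj => ?_⟩
    have h1 := hle j hj
    have h2 := hge j hj
    rcases lt_or_ge j t with hjt | hjt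
    · rw [stepTuple_of_lt hjt]
      by_contra hne
      have h3 := htmin j (Finset.mem_filter.2 ⟨hj, by omega⟩)
      exact absurd h3 (not_le.2 hjt)
    · rw [stepTuple_of_le hjt]
      have := hanti t ht.1 j hj hjt
      omega

theorem IsValueChange.unique {S : Finset (Fin d)} {q : Fin d → ℕ} {t t' : Fin d}
    (h : IsValueChange S q t) (h' : IsValueChange S q t') : t = t' := by
  rcases h with ⟨h1, h2⟩ | ⟨h1, h2⟩ <;> rcases h' with ⟨h1', h2'⟩ | ⟨h1', h2'⟩
  · exact h2.unique h2'
  · exact absurd h1 h1'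
  · exact absurd h1' h1
  · exact h2.unique h2'

theorem IsValueChange.congr {S : Finset (Fin d)} {q q' : Fin d → ℕ} {t : Fin d}
    (hq : ∀ j ∈ S, q j = q' j) (h : IsValueChange S q t) : IsValueChange S q' t := by
  have hconst : (∀ i ∈ S, ∀ j ∈ S, q i = q j) ↔ ∀ i ∈ S, ∀ j ∈ S, q' i = q' j := by
    constructor
    · intro h i hi j hj
      rw [← hq i hi, ← hq j hj, h i hi j hj]
    · intro h i hi j hj
      rw [hq i hi, hq j hj, h i hi j hj]
  have hset : {j : Fin d | j ∈ S ∧ ∃ i, IsPredIn S i j ∧ q j < q i} =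
      {j : Fin d | j ∈ S ∧ ∃ i, IsPredIn S i j ∧ q' j < q' i} := by
    ext j
    refine and_congr_right fun hj => exists_congr fun i => and_congr_right fun hi => ?_
    rw [hq j hj, hq i hi.1.1]
  unfold IsValueChange at *
  rwa [← hconst, ← hset]

/-- The indices in `S` which remain after the removal of the first `k` members of `s`. -/
def freeIn (S : Finset (Fin d)) (s : ℕ → Fin d) (k : ℕ) : Finset (Fin d) :=
  S.filter fun j => ∀ l < k, s l ≠ j

/-- `IsDaisyData` with the set of directions `S` in place of the set of all directions. -/
structure IsDaisyDataOn (S : Finset (Fin d)) (h : ℕ) (q : ℕ → Fin d → ℕ) (s : ℕ → Fin d) :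
    Prop where
  h_lt : h < S.card
  do1 : ∀ k ≤ h, IsDO1On (freeIn S s k) (q k)
  change : ∀ k < h, IsValueChange (freeIn S s k) (q k) (s k)
  le : ∀ k < h, ∀ i ∈ freeIn S s (k + 1), q (k + 1) i ≤ q k i
  lt : ∀ k < h, ∃ i ∈ freeIn S s (k + 1), q (k + 1) i < q k i

/-- Membership in the `k`-th layer, as far as the directions in `S` are concerned. -/
def InLayer (S : Finset (Fin d)) (q : ℕ → Fin d → ℕ) (s : ℕ → Fin d) (k : ℕ) (x : Fin d → ℕ) :
    Prop :=
  (∀ j ∈ freeIn S s k, 1 ≤ x j ∧ x j ≤ q k j) ∧ ∀ l < k, x (s l) = q l (s l) + 1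

theorem freeIn_zero (S : Finset (Fin d)) (s : ℕ → Fin d) : freeIn S s 0 = S := by
  simp [freeIn]

theorem freeIn_succ (S : Finset (Fin d)) (s : ℕ → Fin d) (k : ℕ) :
    freeIn S s (k + 1) = freeIn (S.erase (s 0)) (fun l => s (l + 1)) k := by
  ext j
  simp only [freeIn, Finset.mem_filter, Finset.mem_erase, Nat.forall_lt_succ_left]
  constructor
  · rintro ⟨h1, h2, h3⟩
    exact ⟨⟨h2.symm, h1⟩, h3⟩
  · rintro ⟨⟨h1, h2⟩, h3⟩
    exact ⟨h2, h1.symm, h3⟩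

theorem isDaisyData_iff {h : ℕ} {q : ℕ → Fin d → ℕ} {s : ℕ → Fin d} :
    IsDaisyData h q s ↔ IsDaisyDataOn Finset.univ h q s := by
  constructor
  · rintro ⟨h1, h2, h3, h4, h5⟩
    exact ⟨by simpa using h1, h2, h3, h4, h5⟩
  · rintro ⟨h1, h2, h3, h4, h5⟩
    exact ⟨by simpa using h1, h2, h3, h4, h5⟩

/-- Splits off the largest layer and shifts the data by one, which matches the step `DaisyOn.cons`.
-/
theorem isDaisyDataOn_succ_iff {S : Finset (Fin d)} {h : ℕ} {q : ℕ → Fin d → ℕ} {s : ℕ → Fin d}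
    (hs : s 0 ∈ S) :
    IsDaisyDataOn S (h + 1) q s ↔ IsDO1On S (q 0) ∧ IsValueChange S (q 0) (s 0) ∧
      (∀ i ∈ S.erase (s 0), q 1 i ≤ q 0 i) ∧ (∃ i ∈ S.erase (s 0), q 1 i < q 0 i) ∧
      IsDaisyDataOn (S.erase (s 0)) h (fun k => q (k + 1)) fun k => s (k + 1) := by
  have hcard := Finset.card_erase_add_one hs
  have h1 : freeIn S s 1 = S.erase (s 0) := by rw [freeIn_succ, freeIn_zero]
  constructor
  · rintro ⟨hlt, hdo, hch, hle, hls⟩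
    have e0 := hdo 0 (by omega)
    have e1 := hch 0 (by omega)
    have e2 := hle 0 (by omega)
    have e3 := hls 0 (by omega)
    rw [freeIn_zero] at e0 e1
    rw [zero_add, h1] at e2 e3
    refine ⟨e0, e1, e2, e3, by omega, fun k hk => ?_, fun k hk => ?_, fun k hk => ?_, fun k hk => ?_⟩
    · rw [← freeIn_succ]; exact hdo (k + 1) (by omega)
    · rw [← freeIn_succ]; exact hch (k + 1) (by omega)
    · rw [← freeIn_succ]; exact hle (k + 1) (by omega)
    · rw [← freeIn_succ]; exact hls (k + 1) (by omega)
  · rintro ⟨e0, e1, e2, e3, hlt, hdo, hch, hle, hls⟩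
    simp only [← freeIn_succ] at hdo hch hle hls
    refine ⟨by omega, fun k hk => ?_, fun k hk => ?_, fun k hk => ?_, fun k hk => ?_⟩ <;>
      rcases k with _ | k
    · rwa [freeIn_zero]
    · exact hdo k (by omega)
    · rwa [freeIn_zero]
    · exact hch k (by omega)
    · rwa [zero_add, h1]
    · exact hle k (by omega)
    · rwa [zero_add, h1]
    · exact hls k (by omega)

theorem inLayer_zero {S : Finset (Fin d)} {q : ℕ → Fin d → ℕ} {s : ℕ → Fin d} {x : Fin d → ℕ} :
    InLayer S q s 0 x ↔ ∀ j ∈ S, 1 ≤ x j ∧ x j ≤ q 0 j := by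
  simp [InLayer, freeIn_zero]

theorem inLayer_succ {S : Finset (Fin d)} {q : ℕ → Fin d → ℕ} {s : ℕ → Fin d} {k : ℕ}
    {x : Fin d → ℕ} : InLayer S q s (k + 1) x ↔ x (s 0) = q 0 (s 0) + 1 ∧
      InLayer (S.erase (s 0)) (fun k => q (k + 1)) (fun k => s (k + 1)) k x := by
  simp only [InLayer, freeIn_succ, Nat.forall_lt_succ_left]
  tauto

theorem exists_inLayer_succ {S : Finset (Fin d)} {h : ℕ} {q : ℕ → Fin d → ℕ} {s : ℕ → Fin d}
    {x : Fin d → ℕ} : (∃ k ≤ h + 1, InLayer S q s k x) ↔ (∀ j ∈ S, 1 ≤ x j ∧ x j ≤ q 0 j) ∨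
      (x (s 0) = q 0 (s 0) + 1 ∧
        ∃ k ≤ h, InLayer (S.erase (s 0)) (fun k => q (k + 1)) (fun k => s (k + 1)) k x) := by
  constructor
  · rintro ⟨k, hk, hx⟩
    rcases k with _ | k
    · exact .inl (inLayer_zero.1 hx)
    · rw [inLayer_succ] at hx
      exact .inr ⟨hx.1, k, by omega, hx.2⟩
  · rintro (hx | ⟨hx, k, hk, hx'⟩)
    · exact ⟨0, by omega, inLayer_zero.2 hx⟩
    · exact ⟨k + 1, by omega, inLayer_succ.2 ⟨hx, hx'⟩⟩

theorem mem_boxOn_union_iff {S : Finset (Fin d)} {z q x : Fin d → ℕ} {t : Fin d} (ht : t ∈ S)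
    {C : Finset (Fin d → ℕ)} {P : Prop} {c : ℕ} (hc : q t = c)
    (hC : x ∈ C ↔ (∀ j ∉ S.erase t, x j = Function.update z t (c + 1) j) ∧ P) :
    x ∈ boxOn S z q ∪ C ↔
      (∀ j ∉ S, x j = z j) ∧ ((∀ j ∈ S, 1 ≤ x j ∧ x j ≤ q j) ∨ x t = q t + 1 ∧ P) := by
  have hoff : (∀ j ∉ S.erase t, x j = Function.update z t (c + 1) j) ↔
      (∀ j ∉ S, x j = z j) ∧ x t = q t + 1 := by
    constructor
    · intro h
      refine ⟨fun j hj => ?_, ?_⟩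
      · have := h j fun h => hj (Finset.mem_of_mem_erase h)
        rwa [Function.update_of_ne (by rintro rfl; exact hj ht)] at this
      · have := h t (by simp)
        rwa [Function.update_self, ← hc] at this
    · rintro ⟨h1, h2⟩ j hj
      by_cases hjt : j = t
      · subst hjt
        rw [Function.update_self, h2, hc]
      · rw [Function.update_of_ne hjt]
        exact h1 j fun h => hj (Finset.mem_erase.2 ⟨hjt, h⟩)
  rw [Finset.mem_union, mem_boxOn, hC, hoff]
  tauto

theorem boxOn_congr {S : Finset (Fin d)} {z q q' : Fin d → ℕ} (h : ∀ j ∈ S, q j = q' j) :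
    boxOn S z q = boxOn S z q' := by
  ext x
  rw [mem_boxOn, mem_boxOn]
  refine and_congr_left fun _ => forall₂_congr fun j hj => ?_
  rw [h j hj]

theorem IsDaisyDataOn.exists_daisyOn {S : Finset (Fin d)} {h : ℕ} {q : ℕ → Fin d → ℕ}
    {s : ℕ → Fin d} (hdata : IsDaisyDataOn S h q s) (z : Fin d → ℕ) :
    ∃ c t C, DaisyOn S z c t C ∧ (∀ j ∈ S, q 0 j = stepTuple c t j) ∧
      ∀ x, x ∈ C ↔ (∀ j ∉ S, x j = z j) ∧ ∃ k ≤ h, InLayer S q s k x := by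
  induction h generalizing S q s z with
  | zero =>
    have hS : S.Nonempty := Finset.card_pos.1 hdata.h_lt
    have hdo := hdata.do1 0 le_rfl
    rw [freeIn_zero] at hdo
    obtain ⟨c, t, ht, hc, hq⟩ := hdo.exists_eq_stepTuple hS
    refine ⟨c, t, _, .box S z c t ht hc, hq, fun x => ?_⟩
    rw [← boxOn_congr hq, mem_boxOn]
    simp only [Nat.le_zero, exists_eq_left, inLayer_zero]
    tauto
  | succ h ih =>
    have hS : S.Nonempty := Finset.card_pos.1 (by have := hdata.h_lt; omega)
    have hdo := hdata.do1 0 (by omega)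
    have hch := hdata.change 0 (by omega)
    rw [freeIn_zero] at hdo hch
    obtain ⟨c, t, ht, hc, hq⟩ := hdo.exists_eq_stepTuple hS
    obtain rfl : s 0 = t := (hch.congr hq).unique (isValueChange_stepTuple ht)
    obtain ⟨-, -, hle, ⟨i, hi, hlt⟩, hrec⟩ := (isDaisyDataOn_succ_iff ht).1 hdata
    obtain ⟨c', t', C, hC, hq', hmem⟩ := ih hrec (Function.update z (s 0) (c + 1))
    refine ⟨c, s 0, _, .cons S z c (s 0) ht hc c' t' C hC (fun j hj => ?_) ⟨i, hi, ?_⟩, hq,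
      fun x => ?_⟩
    · rw [← hq' j hj, ← hq j (Finset.mem_of_mem_erase hj)]
      exact hle j hj
    · rw [← hq' i hi, ← hq i (Finset.mem_of_mem_erase hi)]
      exact hlt
    · rw [← boxOn_congr hq, mem_boxOn_union_iff ht (by rw [hq _ ht, stepTuple_self]) (hmem x),
        exists_inLayer_succ]

theorem DaisyOn.exists_isDaisyDataOn {S : Finset (Fin d)} {z : Fin d → ℕ} {c : ℕ} {t : Fin d}
    {C : Finset (Fin d → ℕ)} (hD : DaisyOn S z c t C) :
    ∃ h q s, IsDaisyDataOn S h q s ∧ q 0 = stepTuple c t ∧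
      ∀ x, x ∈ C ↔ (∀ j ∉ S, x j = z j) ∧ ∃ k ≤ h, InLayer S q s k x := by
  induction hD with
  | box S z c t ht hc =>
    refine ⟨0, fun _ => stepTuple c t, fun _ => t, ⟨Finset.card_pos.2 ⟨t, ht⟩,
      fun k _ => isDO1On_stepTuple hc, by simp, by simp, by simp⟩, rfl, fun x => ?_⟩
    rw [mem_boxOn]
    simp only [Nat.le_zero, exists_eq_left, inLayer_zero]
    tauto
  | cons S z c t ht hc c' t' C hC hle hlt ih =>
    obtain ⟨h, q, s, hdata, hq, hmem⟩ := ih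
    refine ⟨h + 1, fun k => Nat.casesOn k (stepTuple c t) q, fun k => Nat.casesOn k t s,
      (isDaisyDataOn_succ_iff ht).2 ⟨isDO1On_stepTuple hc, isValueChange_stepTuple ht, ?_, ?_,
        hdata⟩, rfl, fun x => ?_⟩
    · rw [← hq] at hle
      exact hle
    · rw [← hq] at hlt
      exact hlt
    · rw [mem_boxOn_union_iff ht (stepTuple_self c t) (hmem x), exists_inLayer_succ]
      exact Iff.rfl

theorem IsDaisyData.mem_freeIndices {h : ℕ} {q : ℕ → Fin d → ℕ} {s : ℕ → Fin d}
    (hdata : IsDaisyData h q s) {k : ℕ} (hk : k < h) : s k ∈ freeIndices s k := by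
  rcases hdata.change k hk with ⟨_, h⟩ | ⟨_, h⟩
  · exact h.1
  · exact h.1.1

/-- The index `s l` is free up to stage `l` and fixed afterwards. -/
theorem IsDaisyData.lastFree_eq {h : ℕ} {q : ℕ → Fin d → ℕ} {s : ℕ → Fin d}
    (hdata : IsDaisyData h q s) {k l : ℕ} (hk : k ≤ h) (hl : l < k) : lastFree s (s l) k = l := by
  unfold lastFree
  rw [Nat.findGreatest_eq_iff]
  refine ⟨by omega, fun _ => hdata.mem_freeIndices (by omega), fun m hm _ hmem => ?_⟩
  exact (Finset.mem_filter.1 hmem).2 l hm rfl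

theorem mem_daisyLayer_iff {h : ℕ} {q : ℕ → Fin d → ℕ} {s : ℕ → Fin d} (hdata : IsDaisyData h q s)
    {k : ℕ} (hk : k ≤ h) (z : Fin d → ℤ) :
    z ∈ daisyLayer q s k ↔ ∃ x, InLayer Finset.univ q s k x ∧ toLattice x = z := by
  constructor
  · intro hz
    have hpos : ∀ j, 0 ≤ z j := by
      intro j
      by_cases hj : j ∈ freeIndices s k
      · have := (hz j).1 hj
        omega
      · have := (hz j).2 hj
        omega
    have hcast : toLattice (fun j => (z j).toNat) = z := by
      funext j
      exact Int.toNat_of_nonneg (hpos j)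
    refine ⟨fun j => (z j).toNat, ⟨fun j hj => ?_, fun l hl => ?_⟩, hcast⟩
    · have := (hz j).1 hj
      simp only
      omega
    · have hn : s l ∉ freeIndices s k := fun hmem => (Finset.mem_filter.1 hmem).2 l hl rfl
      have := (hz (s l)).2 hn
      rw [hdata.lastFree_eq hk hl] at this
      simp only
      omega
  · rintro ⟨x, ⟨h1, h2⟩, rfl⟩ j
    refine ⟨fun hj => ?_, fun hj => ?_⟩
    · have := h1 j hj
      simp only [toLattice]
      omega
    · obtain ⟨l, hl, rfl⟩ : ∃ l < k, s l = j := by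
        by_contra! hall
        exact hj (Finset.mem_filter.2 ⟨Finset.mem_univ _, hall⟩)
      rw [hdata.lastFree_eq hk hl]
      have := h2 l hl
      simp only [toLattice]
      omega

theorem isDaisy_iff_exists_daisyOn {Q : Set (Fin d → ℤ)} :
    IsDaisy Q ↔ ∃ (c : ℕ) (t : Fin d) (C : Finset (Fin d → ℕ)), DaisyOn Finset.univ 0 c t C ∧
      Q = toLattice '' (C : Set (Fin d → ℕ)) := by
  have key : ∀ {h : ℕ} {q : ℕ → Fin d → ℕ} {s : ℕ → Fin d} {C : Finset (Fin d → ℕ)},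
      IsDaisyData h q s →
      (∀ x, x ∈ C ↔ (∀ j ∉ Finset.univ, x j = (0 : Fin d → ℕ) j) ∧
        ∃ k ≤ h, InLayer Finset.univ q s k x) →
      {z | ∃ k ≤ h, z ∈ daisyLayer q s k} = toLattice '' (C : Set (Fin d → ℕ)) := by
    intro h q s C hdata hC
    ext z
    simp only [Set.mem_ofPred_eq, Set.mem_image, Finset.mem_coe, hC]
    constructor
    · rintro ⟨k, hk, hz⟩
      obtain ⟨x, hx, rfl⟩ := (mem_daisyLayer_iff hdata hk z).1 hz
      exact ⟨x, ⟨by simp, k, hk, hx⟩, rfl⟩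
    · rintro ⟨x, ⟨-, k, hk, hx⟩, rfl⟩
      exact ⟨k, hk, (mem_daisyLayer_iff hdata hk _).2 ⟨x, hx, rfl⟩⟩
  constructor
  · rintro ⟨h, q, s, hdata, rfl⟩
    obtain ⟨c, t, C, hC, -, hmem⟩ := (isDaisyData_iff.1 hdata).exists_daisyOn 0
    exact ⟨c, t, C, hC, key hdata hmem⟩
  · rintro ⟨c, t, C, hC, rfl⟩
    obtain ⟨h, q, s, hdata, -, hmem⟩ := hC.exists_isDaisyDataOn
    exact ⟨h, q, s, isDaisyData_iff.2 hdata, (key (isDaisyData_iff.2 hdata) hmem).symm⟩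

end Data

/-! ### The theorem -/

section Main

variable {d : ℕ}

theorem encard_image_toLattice (C : Finset (Fin d → ℕ)) :
    (toLattice '' (C : Set (Fin d → ℕ))).encard = C.card := by
  rw [toLattice_injective.encard_image, Set.encard_coe_eq_coe_finsetCard]

theorem DaisyOn.isFirstString {z : Fin d → ℕ} {c : ℕ} {t : Fin d} {C : Finset (Fin d → ℕ)}
    (h : DaisyOn Finset.univ z c t C) : IsFirstString C.card (C : Set (Fin d → ℕ)) :=
  ⟨fun x hx i => ((h.bound x hx).1 i (Finset.mem_univ i)).1, Set.encard_coe_eq_coe_finsetCard C,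
    fun x hx y hy hyn => h.precOn x hx y (fun j _ => hy j)
      (fun j hj => absurd (Finset.mem_univ j) hj) hyn⟩

theorem DaisyOn.isEIPMinimizer {z : Fin d → ℕ} {c : ℕ} {t : Fin d} {C : Finset (Fin d → ℕ)}
    (h : DaisyOn Finset.univ z c t C) :
    IsEIPMinimizer (toLattice '' (C : Set (Fin d → ℕ))) := by
  have : Nonempty (Fin d) := ⟨t⟩
  refine ⟨C.finite_toSet.image _, ⟨_, rfl, rfl⟩, ?_⟩
  rintro p ⟨C', hC', rfl⟩
  rw [encard_image_toLattice] at hC'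
  obtain ⟨E, rfl⟩ := (Set.finite_of_encard_eq_coe hC').exists_finset_coe
  rw [Set.encard_coe_eq_coe_finsetCard, Nat.cast_inj] at hC'
  have h1 := edgePerimeter_toLattice_le
    (fun x hx i => ((h.bound x hx).1 i (Finset.mem_univ i)).1)
    (fun x hx i => h.update_mem x hx i (Finset.mem_univ i))
  have h2 := h.shadowSum_le
  have h3 := minShadow_le_shadowSum Finset.univ E (by simp)
  rw [hC'] at h3
  refine h1.trans (le_trans ?_ (two_mul_shadowSum_le_edgePerimeter E))
  exact_mod_cast Nat.mul_le_mul_left 2 (h2.trans h3)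

end Main

theorem theorem2p2 (n d : ℕ) (hn : 1 ≤ n) (hd : 1 ≤ d) :
    (∃! Q : Set (Fin d → ℤ), IsDaisy Q ∧ Q.encard = n) ∧
    ∀ Q : Set (Fin d → ℤ), IsDaisy Q → Q.encard = n →
      (∃ F : Set (Fin d → ℕ), IsFirstString n F ∧ Q = toLattice '' F) ∧
      IsEIPMinimizer Q := by
  have main : ∀ Q : Set (Fin d → ℤ), IsDaisy Q → Q.encard = n →
      (∃ F : Set (Fin d → ℕ), IsFirstString n F ∧ Q = toLattice '' F) ∧ IsEIPMinimizer Q := by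
    intro Q hQ hcard
    obtain ⟨c, t, C, hC, rfl⟩ := isDaisy_iff_exists_daisyOn.1 hQ
    rw [encard_image_toLattice, Nat.cast_inj] at hcard
    exact ⟨⟨C, hcard ▸ hC.isFirstString, rfl⟩, hC.isEIPMinimizer⟩
  refine ⟨?_, main⟩
  obtain ⟨c, t, C, hC, hcard⟩ := exists_daisyOn_card (Finset.univ : Finset (Fin d))
    ⟨⟨0, hd⟩, Finset.mem_univ _⟩ 0 n hn
  refine ⟨_, ⟨isDaisy_iff_exists_daisyOn.2 ⟨c, t, C, hC, rfl⟩, ?_⟩, ?_⟩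
  · rw [encard_image_toLattice, hcard]
  · rintro Q ⟨hQ, hQn⟩
    obtain ⟨⟨F, hF, rfl⟩, -⟩ := main Q hQ hQn
    -- Any daisy of size `n` is the string of the first `n` tuples, so uniqueness of that string
    -- gives uniqueness of the daisy.
    rw [hF.unique (hcard ▸ hC.isFirstString)]
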